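/- For every real $r\ge 2$ there is a constant $C_r$, depending only on $r$, such that the following holds. Let $N>2q\ge 1$ be integers and let $R,x>0$. Let $(X_i)_{i\ge 1}$ be a strictly stationary sequence of random variables on a probability space $(\Omega,\mathcal F,\mathbb P)$ with values in a separable metric space $(S,d)$ (with its Borel $\sigma$-algebra), and let $h\colon S^2\to\mathbb H$ be a measurable function, where $\mathbb H$ is a (real) separable Hilbert space. Let $X_1'$ be an independent copy of $X_1$ (possibly defined after enlarging the probability space), suppose that $h(X_1,X_1')$ is integrable and that $$\mathbb E[h(X_1,X_1')\mid X_1]=\mathbb E[h(X_1,X_1')\mid X_1']=0\quad\text{almost surely},$$ and put $H:=\|h(X_1,X_1')\|_{\mathbb H}$. Then $$\mathbb P\Big(\max_{2\le n\le N}\Big\|\sum_{1\le i<j\le n}h(X_i,X_j)\Big\|_{\mathbb H}>x\Big)\le C_r x^{-r}q^rN^r\,\mathbb E\big[H^r\mathbf 1_{\{H\le R\}}\big]+C_r x^{-1}N^2\,\mathbb E\big[H\mathbf 1_{\{H>R\}}\big]+C_r x^{-1}qN\sup_{j\ge 2}\mathbb E\|h(X_1,X_j)\|_{\mathbb H}+4N\beta(q),$$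 where the supremum may be $+\infty$. Here $\beta(k):=\sup_{\ell\ge 1}\beta\big(\sigma(X_i,1\le i\le \ell),\sigma(X_i,i\ge \ell+k)\big)$, and for sub-$\sigma$-algebras $\mathcal A,\mathcal B$ of $\mathcal F$, $\beta(\mathcal A,\mathcal B):=\frac12\sup\sum_{i=1}^I\sum_{j=1}^J|\mathbb P(A_i\cap B_j)-\mathbb P(A_i)\mathbb P(B_j)|$, the supremum running over all finite partitions $(A_i)_{i=1}^I$ and $(B_j)_{j=1}^J$ of $\Omega$ into elements of $\mathcal A$ and of $\mathcal B$ respectively. -/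

import Mathlib

open MeasureTheory ProbabilityTheory
open scoped ENNReal NNReal

namespace UStatMixing

/-- `A 0, …, A (I - 1)` is a finite partition of `Ω` into elements of the `σ`-algebra `m`
(empty cells are allowed; they contribute nothing to the sums below). -/
def IsFinPartition {Ω : Type*} (m : MeasurableSpace Ω) {I : ℕ} (A : Fin I → Set Ω) : Prop :=
  (∀ i, MeasurableSet[m] (A i)) ∧ Pairwise (fun i j => Disjoint (A i) (A j)) ∧
    (⋃ i, A i) = Set.univ

/-- The `β`-mixing coefficient between the `σ`-algebras `m₁` and `m₂`:
one half of the supremum of `∑ i, ∑ j, |P (A i ∩ B j) - P (A i) P (B j)|` over all finite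
partitions `A` of `Ω` into elements of `m₁` and `B` of `Ω` into elements of `m₂`. -/
noncomputable def betaCoeff {Ω : Type*} [MeasurableSpace Ω] (P : Measure Ω)
    (m₁ m₂ : MeasurableSpace Ω) : ℝ≥0∞ :=
  2⁻¹ * ⨆ (I : ℕ) (J : ℕ) (A : Fin I → Set Ω) (B : Fin J → Set Ω)
    (_ : IsFinPartition m₁ A) (_ : IsFinPartition m₂ B),
    ∑ i, ∑ j, ENNReal.ofReal |P.real (A i ∩ B j) - P.real (A i) * P.real (B j)|

/-- The `σ`-algebra generated by the `X i`, `i ∈ s`. -/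
abbrev sigmaGen {Ω S : Type*} [mS : MeasurableSpace S] (X : ℕ → Ω → S) (s : Set ℕ) :
    MeasurableSpace Ω :=
  ⨆ i ∈ s, MeasurableSpace.comap (X i) mS

/-- The coefficient `β(k) = sup_{ℓ ≥ 1} β(σ(X_i, 1 ≤ i ≤ ℓ), σ(X_i, i ≥ ℓ + k))` of the sequence
`(X_i)_{i ≥ 1}` (the value `X 0` is not used). -/
noncomputable def betaMixing {Ω S : Type*} [MeasurableSpace Ω] [MeasurableSpace S]
    (P : Measure Ω) (X : ℕ → Ω → S) (k : ℕ) : ℝ≥0∞ :=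
  ⨆ (ℓ : ℕ) (_ : 1 ≤ ℓ),
    betaCoeff P (sigmaGen X (Set.Icc 1 ℓ)) (sigmaGen X (Set.Ici (ℓ + k)))

/-- Strict stationarity of the sequence of random variables `(X_i)_{i ≥ 1}`: every `X_i` is
measurable and, for each `k`, the sequences `(X_{i+k})_{i ≥ 1}` and `(X_i)_{i ≥ 1}` have the same
law on the sequence space (the value `X 0` is not used). -/
def StrictlyStationary {Ω S : Type*} [MeasurableSpace Ω] [MeasurableSpace S]
    (P : Measure Ω) (X : ℕ → Ω → S) : Prop :=
  (∀ i, 1 ≤ i → Measurable (X i)) ∧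
    ∀ k : ℕ, Measure.map (fun ω (i : ℕ) => X (i + 1 + k) ω) P =
      Measure.map (fun ω (i : ℕ) => X (i + 1) ω) P

/-- The `U`-statistic `∑_{1 ≤ i < j ≤ n} h (X_i, X_j)`. -/
def uStat {Ω S E : Type*} [AddCommMonoid E] (h : S → S → E) (X : ℕ → Ω → S) (n : ℕ) (ω : Ω) : E :=
  ∑ j ∈ Finset.Icc 1 n, ∑ i ∈ Finset.Ico 1 j, h (X i ω) (X j ω)

/-- `max_{2 ≤ n ≤ N} ‖∑_{1 ≤ i < j ≤ n} h (X_i, X_j)‖`. -/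
noncomputable def maxUStat {Ω S E : Type*} [NormedAddCommGroup E] (h : S → S → E)
    (X : ℕ → Ω → S) (N : ℕ) (ω : Ω) : ℝ≥0 :=
  (Finset.Icc 2 N).sup fun n => ‖uStat h X n ω‖₊

/-- `ξ, ξ'` are independent random variables on the probability space `(Ω', P')`, each distributed
as the random variable `Y` on `(Ω, P)`; that is, `(ξ, ξ')` is a realisation of the pair formed by
`Y` and an independent copy of `Y`. -/
structure IsIndepCopyPair {Ω Ω' S : Type*} [MeasurableSpace Ω] [MeasurableSpace Ω']
    [MeasurableSpace S] (P : Measure Ω) (Y : Ω → S) (P' : Measure Ω') (ξ ξ' : Ω' → S) : Prop where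
  measurable_fst : Measurable ξ
  measurable_snd : Measurable ξ'
  law_fst : Measure.map ξ P' = Measure.map Y P
  law_snd : Measure.map ξ' P' = Measure.map Y P
  indep : IndepFun ξ ξ' P'

/-- Degeneracy of the kernel `h` with respect to the pair `(ξ, ξ')`: `h (ξ, ξ')` is integrable and
`E[h (ξ, ξ') | ξ] = E[h (ξ, ξ') | ξ'] = 0` almost surely. -/
structure IsDegenerate {Ω' S E : Type*} [MeasurableSpace Ω'] [mS : MeasurableSpace S]
    [NormedAddCommGroup E] [NormedSpace ℝ E] [CompleteSpace E]
    (h : S → S → E) (P' : Measure Ω') (ξ ξ' : Ω' → S) : Prop where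
  integrable : Integrable (fun ω => h (ξ ω) (ξ' ω)) P'
  condExp_fst : P'[fun ω => h (ξ ω) (ξ' ω) | MeasurableSpace.comap ξ mS] =ᵐ[P'] 0
  condExp_snd : P'[fun ω => h (ξ ω) (ξ' ω) | MeasurableSpace.comap ξ' mS] =ᵐ[P'] 0

end UStatMixing

/-! For each shift `s` in {0, 1, 2}, cut the time axis into blocks of length `2q` separated by gaps
of length `q`. The gaps of the three shifts are disjoint, so an index is missed by at most one
shift, and every pair `i < j` has a shift for which both indices lie in blocks. Assign each pair to
one such shift (`inBlock_commonShift`).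

If both indices lie in the same block, then `j - i < 2q`. These near pairs are summed in norm and
bounded by Markov and stationarity, which gives the term with the supremum over `j`
(`measure_nearSum_le`).

For pairs in different blocks, the blocks are replaced one at a time by independent blocks with the
same laws. A gap of length `q` makes each replacement cost at most `2β(q)`, except the first, which
is free (`measure_pair_le`, `measure_splice_le`, `StrictlyStationary.measure_block_le`). About `N /
(3q)` blocks and three shifts keep the total below `4Nβ(q)`.

With independent blocks, write `h = g + d`, where `g` is the completely degenerate projection of `h`
truncated at `R`. Degeneracy of `h` gives `E‖d‖ ≤ 4 E[H; H > R]` (`lintegral_sub_degenProj_le`), and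
Markov in first moment handles `d`. For `g`, fix the offsets `a`, `b` inside the blocks: the sum
over block numbers `u < v` is a martingale in `v`, and each increment is, once block `v` is frozen,
a martingale in `u`. The bound `E‖S_n‖^r ≤ K n^(r/2) max E‖D_k‖^r` (`IsMartDiff.moment_le`), used in
both directions together with Doob, yields order `M^r E‖g‖^r` for `M` blocks
(`IsBddDegenerate.maximal_moment_le`). Adding the `4q²` offsets and using `Mq ≤ 2N` gives `(qN)^r`.
-/

set_option linter.unusedSectionVars false

namespace UStatMixing

/-! ### Elementary inequalities -/

/-- Convexity: the graph of the `p`-th power lies above its tangent at `y`. After scaling by `y`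
this is Bernoulli's inequality. -/
lemma young_rpow {p x y : ℝ} (hp : 1 ≤ p) (hx : 0 ≤ x) (hy : 0 ≤ y) :
    p * (x * y ^ (p - 1)) ≤ x ^ p + (p - 1) * y ^ p := by
  rcases hy.eq_or_lt with rfl | hy
  · rcases hp.eq_or_lt with rfl | hp
    · simp
    · rw [Real.zero_rpow (by linarith), Real.zero_rpow (by linarith)]
      simpa using Real.rpow_nonneg hx p
  · have h := one_add_mul_self_le_rpow_one_add (s := x / y - 1) (by
      have : 0 ≤ x / y := by positivity
      linarith) hp
    rw [add_sub_cancel, Real.div_rpow hx hy.le, le_div_iff₀ (by positivity)] at h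
    have h1 : y ^ p = y * y ^ (p - 1) := by
      rw [Real.rpow_sub_one hy.ne']; field_simp
    have h2 : x / y * y ^ p = x * y ^ (p - 1) := by rw [h1]; field_simp
    linear_combination h - p * h2

/-- A second-order Taylor bound obtained from convexity alone, hence uniform in `p ≥ 1`, including
`p < 2` where the second derivative blows up at `s = -1`. -/
lemma one_add_rpow_le {p s : ℝ} (hp : 1 ≤ p) (hs : -1 ≤ s) (hs' : s ≤ 3) :
    (1 + s) ^ p ≤ 1 + p * s + p ^ 2 * 4 ^ p * s ^ 2 := by
  have h0 : 0 ≤ 1 + s := by linarith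
  have hmul : (1 + s) ^ p = (1 + s) * (1 + s) ^ (p - 1) := by
    rcases h0.eq_or_lt with h | h
    · rw [← h, Real.zero_rpow (by linarith)]; simp
    · rw [Real.rpow_sub_one h.ne']; field_simp
  have h4 : (1 : ℝ) ≤ 4 ^ p := Real.one_le_rpow (by norm_num) (by linarith)
  have ht : (1 + s) ^ p ≤ 1 + p * (s * (1 + s) ^ (p - 1)) := by
    have := young_rpow (x := 1) hp zero_le_one h0
    rw [Real.one_rpow] at this
    nlinarith [hmul]
  have key : s * ((1 + s) ^ (p - 1) - 1) ≤ p * 4 ^ p * s ^ 2 := by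
    rcases le_total 0 s with h | h
    · have hle : (1 + s) ^ (p - 1) ≤ 4 ^ p :=
        (Real.rpow_le_rpow h0 (by linarith) (by linarith)).trans
          (Real.rpow_le_rpow_of_exponent_le (by norm_num) (by linarith))
      have h1 : (1 + s) ^ (p - 1) - 1 ≤ p * 4 ^ p * s := by
        have h2 : (1 + s) * ((1 + s) ^ (p - 1) - 1) ≤ p * (s * (1 + s) ^ (p - 1)) := by
          rw [mul_sub, ← hmul]; linarith
        have h3 : p * (s * (1 + s) ^ (p - 1)) ≤ p * 4 ^ p * s := by
          calc _ ≤ p * (s * 4 ^ p) := by gcongr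
            _ = _ := by ring
        have h5 : 0 ≤ (1 + s) ^ (p - 1) - 1 := by
          have := Real.one_le_rpow (x := 1 + s) (z := p - 1) (by linarith) (by linarith)
          linarith
        nlinarith
      nlinarith
    -- Bernoulli is applied with exponent `p`, since `p - 1` may be below 1; on a base in [0, 1] the
    -- smaller exponent gives the larger power.
    · have h1 : 1 + p * s ≤ (1 + s) ^ (p - 1) :=
        (one_add_mul_self_le_rpow_one_add hs hp).trans
          (Real.rpow_le_rpow_of_exponent_ge' h0 (by linarith) (by linarith) (by linarith))
      have h2 : s * ((1 + s) ^ (p - 1) - 1) ≤ s * (p * s) :=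
        mul_le_mul_of_nonpos_left (by linarith) h
      have h3 : p * s ^ 2 ≤ p * s ^ 2 * 4 ^ p := le_mul_of_one_le_right (by positivity) h4
      nlinarith
  have := mul_le_mul_of_nonneg_left key (by linarith : 0 ≤ p)
  nlinarith

/-- The constant in the second-order expansion of `‖a + b‖ ^ r`. -/
noncomputable def expansionConst (r : ℝ) : ℝ := 2 ^ r + r + 9 * (r ^ 2 * 4 ^ r)

lemma expansionConst_pos {r : ℝ} (hr : 2 ≤ r) : 0 < expansionConst r := by
  unfold expansionConst; positivity

/-- If `‖a‖ ≤ ‖b‖`, every term is absorbed by `‖b‖ ^ r`. Otherwise write `‖a + b‖² = ‖a‖² (1 +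
t/‖a‖²)` with `|t| ≤ 3‖a‖‖b‖` and expand the power `r / 2`. The linear term has the form that
vanishes for martingale increments. -/
lemma norm_add_rpow_le {E : Type*} [NormedAddCommGroup E] [InnerProductSpace ℝ E] {r : ℝ}
    (hr : 2 ≤ r) (a b : E) :
    ‖a + b‖ ^ r ≤ ‖a‖ ^ r + r * inner ℝ (‖a‖ ^ (r - 2) • a) b +
      expansionConst r * (‖a‖ ^ (r - 2) * ‖b‖ ^ 2 + ‖b‖ ^ r) := by
  rw [real_inner_smul_left]
  have hin := abs_le.1 (abs_real_inner_le_norm a b)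
  have hK : 0 ≤ r ^ 2 * (4 : ℝ) ^ r := by positivity
  have h2r : (0 : ℝ) ≤ 2 ^ r := by positivity
  have ha := norm_nonneg a
  have hb := norm_nonneg b
  rcases le_or_gt ‖a‖ ‖b‖ with hab | hab
  · have h1 : ‖a + b‖ ^ r ≤ 2 ^ r * ‖b‖ ^ r := by
      rw [← Real.mul_rpow (by norm_num) hb]
      exact Real.rpow_le_rpow (norm_nonneg _) ((norm_add_le a b).trans (by linarith)) (by linarith)
    have h2 : ‖a‖ ^ (r - 2) * (‖a‖ * ‖b‖) ≤ ‖b‖ ^ r := by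
      rcases hb.eq_or_lt with h | h
      · rw [← h]; simpa using Real.rpow_nonneg le_rfl r
      · calc ‖a‖ ^ (r - 2) * (‖a‖ * ‖b‖) ≤ ‖b‖ ^ (r - 2) * (‖b‖ * ‖b‖) := by
              gcongr
          _ = ‖b‖ ^ r := by
              rw [← pow_two, ← Real.rpow_natCast, ← Real.rpow_add h]; norm_num
    have h3 : -(‖a‖ ^ (r - 2) * (‖a‖ * ‖b‖)) ≤ ‖a‖ ^ (r - 2) * inner ℝ a b := by
      rw [← mul_neg]; gcongr; linarith
    have h4 : 0 ≤ ‖a‖ ^ r := by positivity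
    have h5 : 0 ≤ ‖b‖ ^ r := by positivity
    have h6 : 0 ≤ ‖a‖ ^ (r - 2) * ‖b‖ ^ 2 := by positivity
    have h7 : -(r * ‖b‖ ^ r) ≤ r * (‖a‖ ^ (r - 2) * inner ℝ a b) := by
      rw [← mul_neg]; gcongr; linarith
    have h8 := mul_nonneg (expansionConst_pos hr).le h6
    have h9 : (2 ^ r + r) * ‖b‖ ^ r ≤ expansionConst r * ‖b‖ ^ r := by
      gcongr; unfold expansionConst; linarith
    nlinarith
  · have ha0 : 0 < ‖a‖ := hb.trans_lt hab
    set t : ℝ := 2 * inner ℝ a b + ‖b‖ ^ 2 with ht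
    have hsq : ‖a + b‖ ^ 2 = ‖a‖ ^ 2 * (1 + t / ‖a‖ ^ 2) := by
      rw [norm_add_sq_real, ht]; field_simp; ring
    have hta : |t| ≤ 3 * (‖a‖ * ‖b‖) := by
      rw [abs_le]; constructor <;> nlinarith
    have hs3 : t / ‖a‖ ^ 2 ≤ 3 := by
      rw [div_le_iff₀ (by positivity)]; nlinarith [le_abs_self t]
    have hs1 : -1 ≤ t / ‖a‖ ^ 2 := by
      have : 0 ≤ 1 + t / ‖a‖ ^ 2 := by
        have h := sq_nonneg ‖a + b‖
        rw [hsq] at h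
        exact nonneg_of_mul_nonneg_right h (by positivity)
      linarith
    have hexp := one_add_rpow_le (p := r / 2) (by linarith) hs1 hs3
    have hL : ‖a + b‖ ^ r = ‖a‖ ^ r * (1 + t / ‖a‖ ^ 2) ^ (r / 2) := by
      have e : ∀ x : ℝ, 0 ≤ x → x ^ r = (x ^ 2) ^ (r / 2) := fun x hx => by
        rw [← Real.rpow_natCast, ← Real.rpow_mul hx]; congr 1; push_cast; ring
      rw [e _ (norm_nonneg _), e _ ha, ← Real.mul_rpow (by positivity) (by linarith), hsq]
    have har : ‖a‖ ^ r = ‖a‖ ^ (r - 2) * ‖a‖ ^ 2 := by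
      rw [← Real.rpow_natCast, ← Real.rpow_add ha0]; norm_num
    have hA : 0 ≤ ‖a‖ ^ (r - 2) := by positivity
    have h44 : (4 : ℝ) ^ (r / 2) ≤ 4 ^ r :=
      Real.rpow_le_rpow_of_exponent_le (by norm_num) (by linarith)
    have hKK : (r / 2) ^ 2 * (4 : ℝ) ^ (r / 2) ≤ r ^ 2 * 4 ^ r := by
      gcongr; linarith
    have ht2 : t ^ 2 ≤ 9 * (‖a‖ ^ 2 * ‖b‖ ^ 2) := by
      have := sq_le_sq' (by linarith [abs_nonneg t, neg_abs_le t]) hta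
      rw [sq_abs] at this; nlinarith
    have h5 : 0 ≤ ‖b‖ ^ r := by positivity
    calc ‖a + b‖ ^ r ≤ ‖a‖ ^ r * (1 + r / 2 * (t / ‖a‖ ^ 2) +
            (r / 2) ^ 2 * 4 ^ (r / 2) * (t / ‖a‖ ^ 2) ^ 2) := by
          rw [hL]; gcongr
      _ = ‖a‖ ^ r + r * (‖a‖ ^ (r - 2) * inner ℝ a b) + ‖a‖ ^ (r - 2) * (r / 2 * ‖b‖ ^ 2) +
            ‖a‖ ^ (r - 2) * ((r / 2) ^ 2 * 4 ^ (r / 2) * (t ^ 2 / ‖a‖ ^ 2)) := by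
          rw [har, ht]; field_simp; ring
      _ ≤ ‖a‖ ^ r + r * (‖a‖ ^ (r - 2) * inner ℝ a b) + ‖a‖ ^ (r - 2) * (r * ‖b‖ ^ 2) +
            ‖a‖ ^ (r - 2) * (r ^ 2 * 4 ^ r * (9 * ‖b‖ ^ 2)) := by
          have : t ^ 2 / ‖a‖ ^ 2 ≤ 9 * ‖b‖ ^ 2 := by
            rw [div_le_iff₀ (by positivity)]; linarith
          gcongr
          linarith
      _ ≤ _ := by
          have h6 : 0 ≤ ‖a‖ ^ (r - 2) * ‖b‖ ^ 2 := by positivity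
          have h8 := mul_nonneg (expansionConst_pos hr).le h5
          have h9 := mul_nonneg h2r h6
          unfold expansionConst at *
          nlinarith

/-- Whichever of `s²` and `k d²` is larger dominates. Taking `k = n` leaves only the factor `1/n` on
`s ^ r`, which survives `n` iterations. -/
lemma rpow_mul_sq_le {r s d k : ℝ} (hr : 2 ≤ r) (hs : 0 ≤ s) (hd : 0 ≤ d) (hk : 0 < k) :
    s ^ (r - 2) * d ^ 2 ≤ s ^ r / k + k ^ (r / 2 - 1) * d ^ r := by
  have e : ∀ x : ℝ, 0 ≤ x → x ^ (r - 2) * x ^ 2 = x ^ r := fun x hx => by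
    rcases hx.eq_or_lt with rfl | hx
    · rw [Real.zero_rpow (by linarith : r ≠ 0)]; simp
    · rw [← Real.rpow_natCast, ← Real.rpow_add hx]; norm_num
  rcases le_total (k * d ^ 2) (s ^ 2) with h | h
  · have : s ^ (r - 2) * d ^ 2 ≤ s ^ r / k := by
      rw [le_div_iff₀ hk, ← e s hs, mul_assoc]
      gcongr; linarith
    have : 0 ≤ k ^ (r / 2 - 1) * d ^ r := by positivity
    linarith
  · have h1 : s ^ (r - 2) ≤ k ^ (r / 2 - 1) * d ^ (r - 2) := by
      have e2 : ∀ x : ℝ, 0 ≤ x → x ^ (r - 2) = (x ^ 2) ^ (r / 2 - 1) := fun x hx => by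
        rw [← Real.rpow_natCast, ← Real.rpow_mul hx]; congr 1; push_cast; ring
      rw [e2 s hs, e2 d hd, ← Real.mul_rpow hk.le (by positivity)]
      exact Real.rpow_le_rpow (by positivity) h (by linarith)
    have : s ^ (r - 2) * d ^ 2 ≤ k ^ (r / 2 - 1) * d ^ r := by
      rw [← e d hd, ← mul_assoc]; gcongr
    have : 0 ≤ s ^ r / k := by positivity
    linarith

/-- A pathwise form of Doob's maximal inequality. -/
lemma partialSups_rpow_le {p : ℝ} (hp : 1 < p) (s : ℕ → ℝ) (hs : ∀ k, 0 ≤ s k) (h0 : s 0 = 0)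
    (n : ℕ) :
    (p - 1) * partialSups s n ^ p ≤ p * (s n * partialSups s n ^ (p - 1) -
      ∑ k ∈ Finset.range n, partialSups s k ^ (p - 1) * (s (k + 1) - s k)) := by
  induction n with
  | zero => simp [h0, Real.zero_rpow (by linarith : p ≠ 0)]
  | succ n ih =>
    rw [Finset.sum_range_succ, partialSups_add_one]
    have hM : 0 ≤ partialSups s n := (hs n).trans (le_partialSups s n)
    set M := partialSups s n
    -- Only a new record changes the maximum; at a record this is the tangent inequality
    -- `young_rpow`.
    suffices h : (p - 1) * ((M ⊔ s (n + 1)) ^ p - M ^ p) ≤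
        p * (s (n + 1) * ((M ⊔ s (n + 1)) ^ (p - 1) - M ^ (p - 1))) by linarith
    rcases le_total (s (n + 1)) M with h | h
    · rw [sup_of_le_left h]; simp
    · rw [sup_of_le_right h]
      have hy := young_rpow hp.le (hs (n + 1)) hM
      have : s (n + 1) * s (n + 1) ^ (p - 1) = s (n + 1) ^ p := by
        rcases (hs (n + 1)).eq_or_lt with h | h
        · rw [← h, Real.zero_rpow (by linarith : p ≠ 0), zero_mul]
        · rw [Real.rpow_sub_one h.ne']; field_simp
      nlinarith

/-- The vector `a/‖a‖` is a subgradient of the norm at `a`; at `a = 0` the convention `0⁻¹ = 0`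
gives the subgradient 0. -/
lemma norm_add_sub_norm_ge {E : Type*} [NormedAddCommGroup E] [InnerProductSpace ℝ E] (a b : E) :
    inner ℝ (‖a‖⁻¹ • a) b ≤ ‖a + b‖ - ‖a‖ := by
  rcases eq_or_ne a 0 with rfl | ha
  · simp
  · have ha' : 0 < ‖a‖ := norm_pos_iff.2 ha
    have h1 : inner ℝ (‖a‖⁻¹ • a) (a + b) ≤ ‖a + b‖ := by
      refine (real_inner_le_norm _ _).trans (le_of_eq ?_)
      rw [norm_smul, norm_inv, norm_norm, inv_mul_cancel₀ ha'.ne', one_mul]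
    have h2 : inner ℝ (‖a‖⁻¹ • a) a = ‖a‖ := by
      rw [real_inner_smul_left, real_inner_self_eq_norm_sq]; field_simp
    rw [inner_add_right, h2] at h1
    linarith

/-! ### Bounded measurable functions -/

/-- A bounded measurable function. -/
def BddMeas {α F : Type*} [MeasurableSpace α] [NormedAddCommGroup F] [MeasurableSpace F]
    (f : α → F) : Prop :=
  Measurable f ∧ ∃ C, ∀ x, ‖f x‖ ≤ C

namespace BddMeas

variable {α β F : Type*} [MeasurableSpace α] [MeasurableSpace β] [NormedAddCommGroup F]
  [MeasurableSpace F] [BorelSpace F] [SecondCountableTopology F]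

lemma comp {f : α → F} (hf : BddMeas f) {g : β → α} (hg : Measurable g) :
    BddMeas (fun x => f (g x)) :=
  ⟨hf.1.comp hg, hf.2.imp fun _ h x => h (g x)⟩

lemma integrable {f : α → F} (hf : BddMeas f) (μ : Measure α) [IsFiniteMeasure μ] :
    Integrable f μ := by
  obtain ⟨hm, C, hC⟩ := hf
  exact Integrable.of_bound hm.aestronglyMeasurable C (Filter.Eventually.of_forall hC)

lemma norm {f : α → F} (hf : BddMeas f) : BddMeas (fun x => ‖f x‖) := by
  obtain ⟨hm, C, hC⟩ := hf
  exact ⟨hm.norm, C, by simpa using hC⟩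

lemma add {f g : α → F} (hf : BddMeas f) (hg : BddMeas g) : BddMeas (fun x => f x + g x) := by
  obtain ⟨hm, C, hC⟩ := hf
  obtain ⟨hm', C', hC'⟩ := hg
  exact ⟨hm.add hm', C + C', fun x => (norm_add_le _ _).trans (add_le_add (hC x) (hC' x))⟩

lemma sub {f g : α → F} (hf : BddMeas f) (hg : BddMeas g) : BddMeas (fun x => f x - g x) := by
  obtain ⟨hm, C, hC⟩ := hf
  obtain ⟨hm', C', hC'⟩ := hg
  exact ⟨hm.sub hm', C + C', fun x => (norm_sub_le _ _).trans (add_le_add (hC x) (hC' x))⟩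

lemma sum {ι : Type*} {f : ι → α → F} (s : Finset ι) (hf : ∀ i ∈ s, BddMeas (f i)) :
    BddMeas (fun x => ∑ i ∈ s, f i x) := by
  classical
  induction s using Finset.induction_on with
  | empty => exact ⟨by simp, 0, by simp⟩
  | insert i s hi ih =>
    simp_rw [Finset.sum_insert hi]
    exact (hf i (by simp)).add (ih fun j hj => hf j (by simp [hj]))

lemma mul {f g : α → ℝ} (hf : BddMeas f) (hg : BddMeas g) : BddMeas (fun x => f x * g x) := by
  obtain ⟨hm, C, hC⟩ := hf
  obtain ⟨hm', C', hC'⟩ := hg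
  refine ⟨hm.mul hm', C * C', fun x => ?_⟩
  rw [norm_mul]
  exact mul_le_mul (hC x) (hC' x) (norm_nonneg _) ((norm_nonneg _).trans (hC x))

lemma smul [NormedSpace ℝ F] {f : α → ℝ} {g : α → F} (hf : BddMeas f) (hg : BddMeas g) :
    BddMeas (fun x => f x • g x) := by
  obtain ⟨hm, C, hC⟩ := hf
  obtain ⟨hm', C', hC'⟩ := hg
  refine ⟨hm.smul hm', C * C', fun x => ?_⟩
  rw [norm_smul]
  exact mul_le_mul (hC x) (hC' x) (norm_nonneg _) ((norm_nonneg _).trans (hC x))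

lemma const (c : F) : BddMeas (fun _ : α => c) := ⟨measurable_const, ‖c‖, fun _ => le_rfl⟩

lemma rpow {f : α → ℝ} (hf : BddMeas f) (h0 : ∀ x, 0 ≤ f x) {p : ℝ} (hp : 0 ≤ p) :
    BddMeas (fun x => f x ^ p) := by
  obtain ⟨hm, C, hC⟩ := hf
  refine ⟨hm.pow_const p, C ^ p, fun x => ?_⟩
  rw [Real.norm_of_nonneg (Real.rpow_nonneg (h0 x) p)]
  exact Real.rpow_le_rpow (h0 x) ((le_abs_self _).trans (hC x)) hp

lemma norm_rpow {f : α → F} (hf : BddMeas f) {p : ℝ} (hp : 0 ≤ p) :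
    BddMeas (fun x => ‖f x‖ ^ p) :=
  hf.norm.rpow (fun _ => norm_nonneg _) hp

lemma inner {E : Type*} [NormedAddCommGroup E] [InnerProductSpace ℝ E] [MeasurableSpace E]
    [BorelSpace E] [SecondCountableTopology E] {f g : α → E} (hf : BddMeas f) (hg : BddMeas g) :
    BddMeas (fun x => inner ℝ (f x) (g x)) := by
  obtain ⟨hm, C, hC⟩ := hf
  obtain ⟨hm', C', hC'⟩ := hg
  refine ⟨hm.inner hm', C * C', fun x => (norm_inner_le_norm _ _).trans ?_⟩
  exact mul_le_mul (hC x) (hC' x) (norm_nonneg _) ((norm_nonneg _).trans (hC x))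

lemma sup {f g : α → ℝ} (hf : BddMeas f) (hg : BddMeas g) : BddMeas (fun x => f x ⊔ g x) := by
  obtain ⟨hm, C, hC⟩ := hf
  obtain ⟨hm', C', hC'⟩ := hg
  refine ⟨hm.max hm', max C C', fun x => ?_⟩
  simp only [Real.norm_eq_abs] at *
  exact abs_max_le_max_abs_abs.trans (max_le_max (hC x) (hC' x))

lemma partialSups {f : ℕ → α → ℝ} (hf : ∀ k, BddMeas (f k)) (n : ℕ) :
    BddMeas (fun x => partialSups (fun k => f k x) n) := by
  induction n with
  | zero => simpa using hf 0
  | succ n ih => simpa only [partialSups_add_one] using ih.sup (hf (n + 1))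

end BddMeas

/-! ### Maximal moment inequality for martingales on a product space -/

section Martingale

variable {T : Type*} [MeasurableSpace T] (ν : ℕ → Measure T) [∀ i, IsProbabilityMeasure (ν i)]
variable {E : Type*} [NormedAddCommGroup E] [InnerProductSpace ℝ E] [CompleteSpace E]
  [SecondCountableTopology E] [MeasurableSpace E] [BorelSpace E]

/-- Resampling one coordinate preserves a product measure. With Fubini this plays the role of
conditioning on the other coordinates. -/
lemma measurePreserving_update (k : ℕ) :
    MeasurePreserving (fun p : (ℕ → T) × T => Function.update p.1 k p.2)
      ((Measure.infinitePi ν).prod (ν k)) (Measure.infinitePi ν) := by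
  have hm : Measurable (fun p : (ℕ → T) × T => Function.update p.1 k p.2) := measurable_update'
  refine ⟨hm, Measure.eq_infinitePi _ fun s t ht => ?_⟩
  rw [Measure.map_apply hm (MeasurableSet.pi s.countable_toSet fun i _ => ht i)]
  have hpre : (fun p : (ℕ → T) × T => Function.update p.1 k p.2) ⁻¹' (Set.pi (s : Set ℕ) t) =
      (Set.pi ((s.erase k : Finset ℕ) : Set ℕ) t) ×ˢ (if k ∈ s then t k else Set.univ) := by
    ext ⟨w, y⟩
    simp only [Set.mem_preimage, Set.mem_pi, Set.mem_prod, Finset.mem_coe, Finset.mem_erase]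
    constructor
    · intro h
      refine ⟨fun i hi => ?_, ?_⟩
      · simpa [Function.update_of_ne hi.1] using h i hi.2
      · split_ifs with hk
        · simpa using h k hk
        · trivial
    · rintro ⟨h1, h2⟩ i hi
      rcases eq_or_ne i k with rfl | hik
      · simpa [hi] using h2
      · simpa [Function.update_of_ne hik] using h1 i ⟨hik, hi⟩
  rw [hpre, Measure.prod_prod, Measure.infinitePi_pi _ (fun i _ => ht i)]
  split_ifs with hk
  · exact Finset.prod_erase_mul _ _ hk
  · rw [measure_univ, mul_one, Finset.erase_eq_of_notMem hk]

lemma lintegral_update (k : ℕ) {f : (ℕ → T) → ℝ≥0∞} (hf : Measurable f) :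
    ∫⁻ w, f w ∂(Measure.infinitePi ν) =
      ∫⁻ w, ∫⁻ y, f (Function.update w k y) ∂(ν k) ∂(Measure.infinitePi ν) := by
  have h := measurePreserving_update ν k
  rw [← h.lintegral_comp hf]
  exact lintegral_prod _ (hf.comp h.measurable).aemeasurable

lemma integral_update (k : ℕ) {f : (ℕ → T) → ℝ} (hf : BddMeas f) :
    ∫ w, f w ∂(Measure.infinitePi ν) =
      ∫ w, ∫ y, f (Function.update w k y) ∂(ν k) ∂(Measure.infinitePi ν) := by
  have h := measurePreserving_update ν k
  rw [← integral_prod _ ((hf.comp h.measurable).integrable _), ← h.map_eq,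
    integral_map h.measurable.aemeasurable (hf.1.aestronglyMeasurable), h.map_eq]

lemma update_eq_of_lt {Z : (ℕ → T) → E} {k : ℕ} (hZ : DependsOn Z (Set.Iio k)) (w : ℕ → T)
    (y : T) : Z (Function.update w k y) = Z w :=
  hZ fun _ hi => Function.update_of_ne (ne_of_lt hi) _ _

/-- The constant in the moment inequality for martingales. -/
noncomputable def momentConst (r : ℝ) : ℝ :=
  2 * expansionConst r * Real.exp (expansionConst r)

lemma momentConst_pos {r : ℝ} (hr : 2 ≤ r) : 0 < momentConst r := by
  have := expansionConst_pos hr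
  unfold momentConst; positivity

/-- A sequence of bounded martingale differences on the product space. -/
structure IsMartDiff (D : ℕ → (ℕ → T) → E) : Prop where
  bddMeas : ∀ k, BddMeas (D k)
  dependsOn : ∀ k, DependsOn (D k) (Set.Iio (k + 1))
  centered : ∀ k w, ∫ y, D k (Function.update w k y) ∂(ν k) = 0

variable {ν} {D : ℕ → (ℕ → T) → E}

namespace IsMartDiff

/-- Orthogonality of a martingale increment to the past: resampling coordinate `k` leaves `Z` fixed
and averages `D k` to zero. -/
lemma integral_inner_eq_zero (hD : IsMartDiff ν D) {k : ℕ} {Z : (ℕ → T) → E} (hZ : BddMeas Z)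
    (hZd : DependsOn Z (Set.Iio k)) :
    ∫ w, inner ℝ (Z w) (D k w) ∂(Measure.infinitePi ν) = 0 := by
  rw [integral_update ν k (hZ.inner (hD.bddMeas k))]
  refine integral_eq_zero_of_ae (Filter.Eventually.of_forall fun w => ?_)
  simp_rw [update_eq_of_lt hZd]
  have hm : Measurable (fun y => Function.update w k y) := measurable_update w
  rw [integral_inner (((hD.bddMeas k).comp hm).integrable _), hD.centered, inner_zero_right]
  rfl

lemma bddMeas_sum (hD : IsMartDiff ν D) (n : ℕ) :
    BddMeas (fun w => ∑ k ∈ Finset.range n, D k w) :=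
  BddMeas.sum _ fun k _ => hD.bddMeas k

lemma dependsOn_sum (hD : IsMartDiff ν D) (n : ℕ) :
    DependsOn (fun w => ∑ k ∈ Finset.range n, D k w) (Set.Iio n) := fun _ _ h =>
  Finset.sum_congr rfl fun k hk => hD.dependsOn k fun i hi =>
    h i (lt_of_lt_of_le (Set.mem_Iio.1 hi) (Finset.mem_range.1 hk))

lemma moment_step (hD : IsMartDiff ν D) {r : ℝ} (hr : 2 ≤ r) (j : ℕ) {n : ℕ} (hn : 0 < n) :
    ∫ w, ‖∑ k ∈ Finset.range (j + 1), D k w‖ ^ r ∂(Measure.infinitePi ν) ≤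
      (1 + expansionConst r / n) *
        ∫ w, ‖∑ k ∈ Finset.range j, D k w‖ ^ r ∂(Measure.infinitePi ν) +
      expansionConst r * ((n : ℝ) ^ (r / 2 - 1) + 1) *
        ∫ w, ‖D j w‖ ^ r ∂(Measure.infinitePi ν) := by
  set c := expansionConst r
  have hc : 0 < c := expansionConst_pos hr
  set S : (ℕ → T) → E := fun w => ∑ k ∈ Finset.range j, D k w with hS
  have hSb : BddMeas S := hD.bddMeas_sum j
  have hSr := hSb.norm_rpow (p := r) (by linarith)
  have hDr := (hD.bddMeas j).norm_rpow (p := r) (by linarith)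
  have hZ : BddMeas (fun w => ‖S w‖ ^ (r - 2) • S w) := (hSb.norm_rpow (by linarith)).smul hSb
  have hZd : DependsOn (fun w => ‖S w‖ ^ (r - 2) • S w) (Set.Iio j) := fun x y h => by
    simp only [hD.dependsOn_sum j h, hS]
  have hin := hZ.inner (hD.bddMeas j)
  have hpt : ∀ w, ‖∑ k ∈ Finset.range (j + 1), D k w‖ ^ r ≤
      ((1 + c / n) * ‖S w‖ ^ r + r * inner ℝ (‖S w‖ ^ (r - 2) • S w) (D j w)) +
        c * ((n : ℝ) ^ (r / 2 - 1) + 1) * ‖D j w‖ ^ r := fun w => by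
    rw [Finset.sum_range_succ]
    have h1 := norm_add_rpow_le hr (S w) (D j w)
    have h2 := mul_le_mul_of_nonneg_left (rpow_mul_sq_le (k := n) hr (norm_nonneg (S w))
      (norm_nonneg (D j w)) (by positivity)) hc.le
    have h3 : c * (‖S w‖ ^ r / n) = c / n * ‖S w‖ ^ r := by ring
    rw [mul_add] at h1 h2
    linarith
  have hb1 := (BddMeas.const (α := ℕ → T) (1 + c / n)).mul hSr
  have hb2 := (BddMeas.const (α := ℕ → T) r).mul hin
  have hb3 := (BddMeas.const (α := ℕ → T) (c * ((n : ℝ) ^ (r / 2 - 1) + 1))).mul hDr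
  refine (integral_mono (((hD.bddMeas_sum (j + 1)).norm_rpow (by linarith)).integrable _)
    (((hb1.add hb2).add hb3).integrable _) hpt).trans (le_of_eq ?_)
  rw [integral_add ((hb1.add hb2).integrable _) (hb3.integrable _),
    integral_add (hb1.integrable _) (hb2.integrable _), integral_const_mul, integral_const_mul,
    integral_const_mul, hD.integral_inner_eq_zero hZ hZd, mul_zero, add_zero]

lemma moment_le (hD : IsMartDiff ν D) {r A : ℝ} (hr : 2 ≤ r) {n : ℕ} (hn : 0 < n)
    (hA : ∀ k < n, ∫ w, ‖D k w‖ ^ r ∂(Measure.infinitePi ν) ≤ A) :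
    ∫ w, ‖∑ k ∈ Finset.range n, D k w‖ ^ r ∂(Measure.infinitePi ν) ≤
      momentConst r * (n : ℝ) ^ (r / 2) * A := by
  unfold momentConst
  set c := expansionConst r
  have hc : 0 < c := expansionConst_pos hr
  have hn1 : (1 : ℝ) ≤ n := by exact_mod_cast hn
  have hA0 : 0 ≤ A := (integral_nonneg fun w => by positivity).trans (hA 0 hn)
  have hpow : (1 : ℝ) ≤ (n : ℝ) ^ (r / 2 - 1) := Real.one_le_rpow hn1 (by linarith)
  -- Discrete Gronwall: each step multiplies by `1 + c/n` and adds at most a fixed amount, and `(1 +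
  -- c/n)^n ≤ exp c`.
  have hind : ∀ j ≤ n, ∫ w, ‖∑ k ∈ Finset.range j, D k w‖ ^ r ∂(Measure.infinitePi ν) ≤
      j * (2 * c * (n : ℝ) ^ (r / 2 - 1) * A) * (1 + c / n) ^ j := by
    intro j
    induction j with
    | zero => simp [Real.zero_rpow (by linarith : r ≠ 0)]
    | succ j ih =>
      intro hj
      have h1 : c * ((n : ℝ) ^ (r / 2 - 1) + 1) * ∫ w, ‖D j w‖ ^ r ∂(Measure.infinitePi ν) ≤
          2 * c * (n : ℝ) ^ (r / 2 - 1) * A := by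
        have := hA j (by omega)
        calc _ ≤ c * ((n : ℝ) ^ (r / 2 - 1) + (n : ℝ) ^ (r / 2 - 1)) * A := by gcongr
          _ = _ := by ring
      set L := 2 * c * (n : ℝ) ^ (r / 2 - 1) * A
      have hL : 0 ≤ L := by positivity
      have hx : 1 ≤ (1 + c / n) ^ (j + 1) :=
        one_le_pow₀ (by have : 0 ≤ c / n := by positivity
                        linarith)
      calc _ ≤ (1 + c / n) * (j * L * (1 + c / n) ^ j) + L := by
            refine (hD.moment_step hr j hn).trans (add_le_add ?_ h1)
            gcongr
            exact ih (by omega)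
        _ = j * L * (1 + c / n) ^ (j + 1) + L * 1 := by ring
        _ ≤ j * L * (1 + c / n) ^ (j + 1) + L * (1 + c / n) ^ (j + 1) := by gcongr
        _ = _ := by push_cast; ring
  have hexp : (1 + c / n) ^ n ≤ Real.exp c := by
    calc (1 + c / n) ^ n ≤ Real.exp (c / n) ^ n := by
          gcongr; linarith [Real.add_one_le_exp (c / n)]
      _ = Real.exp c := by rw [← Real.exp_nat_mul]; congr 1; field_simp
  have hnn : (n : ℝ) ^ (r / 2) = n * (n : ℝ) ^ (r / 2 - 1) := by
    rw [Real.rpow_sub_one (by positivity)]; field_simp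
  calc _ ≤ n * (2 * c * (n : ℝ) ^ (r / 2 - 1) * A) * Real.exp c := by
        refine (hind n le_rfl).trans ?_
        gcongr
    _ = _ := by rw [hnn]; ring

/-- The submartingale property of the norm, tested against a nonnegative weight depending on the
past: the subgradient bound reduces it to orthogonality. -/
lemma integral_mul_norm_sub_nonneg (hD : IsMartDiff ν D) {k : ℕ} {M : (ℕ → T) → ℝ}
    (hM : BddMeas M) (hM0 : ∀ w, 0 ≤ M w) (hMd : DependsOn M (Set.Iio k)) :
    0 ≤ ∫ w, M w * (‖∑ i ∈ Finset.range (k + 1), D i w‖ - ‖∑ i ∈ Finset.range k, D i w‖)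
      ∂(Measure.infinitePi ν) := by
  set S : (ℕ → T) → E := fun w => ∑ i ∈ Finset.range k, D i w with hS
  have hSb : BddMeas S := hD.bddMeas_sum k
  have hu : BddMeas (fun w => ‖S w‖⁻¹ • S w) := by
    refine ⟨hSb.1.norm.inv.smul hSb.1, 1, fun w => ?_⟩
    rw [norm_smul, norm_inv, norm_norm]
    exact inv_mul_le_one
  have hZ := hM.smul hu
  have hZd : DependsOn (fun w => M w • ‖S w‖⁻¹ • S w) (Set.Iio k) := fun x y h => by
    simp only [hD.dependsOn_sum k h, hS, hMd h]
  rw [← hD.integral_inner_eq_zero hZ hZd]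
  refine integral_mono ((hZ.inner (hD.bddMeas k)).integrable _)
    ((hM.mul ((hD.bddMeas_sum (k + 1)).norm.sub hSb.norm)).integrable _) fun w => ?_
  simp only [Finset.sum_range_succ]
  rw [real_inner_smul_left]
  exact mul_le_mul_of_nonneg_left (norm_add_sub_norm_ge _ _) (hM0 w)

lemma doob (hD : IsMartDiff ν D) {r : ℝ} (hr : 2 ≤ r) (n : ℕ) :
    ∫ w, partialSups (fun j => ‖∑ k ∈ Finset.range j, D k w‖) n ^ r ∂(Measure.infinitePi ν) ≤
      2 ^ r * ∫ w, ‖∑ k ∈ Finset.range n, D k w‖ ^ r ∂(Measure.infinitePi ν) := by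
  set s : ℕ → (ℕ → T) → ℝ := fun j w => ‖∑ k ∈ Finset.range j, D k w‖ with hs
  have hsb : ∀ j, BddMeas (s j) := fun j => (hD.bddMeas_sum j).norm
  have hMb : ∀ j, BddMeas (fun w => partialSups (fun j => s j w) j) := BddMeas.partialSups hsb
  have hM0 : ∀ j w, 0 ≤ partialSups (fun j => s j w) j := fun j w =>
    (norm_nonneg _).trans (le_partialSups (fun j => s j w) j)
  have hMd : ∀ j, DependsOn (fun w => partialSups (fun j => s j w) j) (Set.Iio j) := by
    intro j x y h
    simp only [partialSups_apply]
    refine Finset.sup'_congr _ rfl fun i hi => ?_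
    simp only [hs]
    congr 1
    exact hD.dependsOn_sum i fun l hl => h l (lt_of_lt_of_le hl (Finset.mem_Iic.1 hi))
  have hMr := (hMb n).rpow (hM0 n) (p := r) (by linarith)
  have hsr := (hsb n).rpow (fun _ => norm_nonneg _) (p := r) (by linarith)
  have hterm : ∀ k, BddMeas fun w => partialSups (fun j => s j w) k ^ (r - 1) *
      (s (k + 1) w - s k w) := fun k =>
    ((hMb k).rpow (hM0 k) (by linarith)).mul ((hsb (k + 1)).sub (hsb k))
  have hsum := BddMeas.sum (Finset.range n) fun k _ => hterm k
  -- Young's inequality at `x = 2 * s n` absorbs half of the maximum's power into the left side;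
  -- hence the constants `(r - 1) / 2` and `2 ^ (r - 1)`.
  have hpt : ∀ w, (r - 1) / 2 * partialSups (fun j => s j w) n ^ r +
      r * ∑ k ∈ Finset.range n, partialSups (fun j => s j w) k ^ (r - 1) *
        (s (k + 1) w - s k w) ≤ 2 ^ (r - 1) * s n w ^ r := fun w => by
    have h1 := partialSups_rpow_le (p := r) (by linarith) (fun j => s j w)
      (fun k => norm_nonneg _) (by simp [hs]) n
    have h2 := young_rpow (p := r) (x := 2 * s n w) (by linarith)
      (mul_nonneg zero_le_two (norm_nonneg _)) (hM0 n w)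
    rw [Real.mul_rpow zero_le_two (norm_nonneg _)] at h2
    have h3 : (2 : ℝ) ^ (r - 1) = 2 ^ r / 2 := Real.rpow_sub_one two_ne_zero r
    rw [h3]
    linarith
  have hint := integral_mono
    ((((BddMeas.const ((r - 1) / 2)).mul hMr).add ((BddMeas.const r).mul hsum)).integrable
      (Measure.infinitePi ν)) (((BddMeas.const (2 ^ (r - 1))).mul hsr).integrable _) hpt
  rw [integral_add (((BddMeas.const ((r - 1) / 2)).mul hMr).integrable _)
    (((BddMeas.const r).mul hsum).integrable _), integral_const_mul, integral_const_mul,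
    integral_const_mul, integral_finsetSum _ (fun k _ => (hterm k).integrable _)] at hint
  have hpos : 0 ≤ ∑ k ∈ Finset.range n, ∫ w, partialSups (fun j => s j w) k ^ (r - 1) *
      (s (k + 1) w - s k w) ∂(Measure.infinitePi ν) :=
    Finset.sum_nonneg fun k _ => hD.integral_mul_norm_sub_nonneg
      ((hMb k).rpow (hM0 k) (by linarith)) (fun w => Real.rpow_nonneg (hM0 k w) _)
      (fun x y h => by simp only [hMd k h])
  have h3 : (2 : ℝ) ^ (r - 1) = 2 ^ r / 2 := Real.rpow_sub_one two_ne_zero r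
  have h4 : 0 ≤ ∫ w, partialSups (fun j => s j w) n ^ r ∂(Measure.infinitePi ν) :=
    integral_nonneg fun w => Real.rpow_nonneg (hM0 n w) _
  have h5 := mul_nonneg (by linarith : 0 ≤ r) hpos
  rw [h3] at hint
  nlinarith

end IsMartDiff

lemma IsMartDiff.maximal_moment_le (hD : IsMartDiff ν D) {r A : ℝ} (hr : 2 ≤ r) {n : ℕ}
    (hn : 0 < n) (hA : ∀ k < n, ∫ w, ‖D k w‖ ^ r ∂(Measure.infinitePi ν) ≤ A) :
    ∫ w, partialSups (fun j => ‖∑ k ∈ Finset.range j, D k w‖) n ^ r ∂(Measure.infinitePi ν) ≤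
      2 ^ r * (momentConst r * (n : ℝ) ^ (r / 2) * A) := by
  refine (hD.doob hr n).trans ?_
  gcongr
  exact hD.moment_le hr hn hA

end Martingale

/-! ### Degenerate kernels evaluated at independent blocks -/

section Kernel

variable {S : Type*} [MeasurableSpace S] {μ : Measure S} [IsProbabilityMeasure μ]
  {ν : ℕ → Measure (ℕ → S)} [∀ i, IsProbabilityMeasure (ν i)]
variable {E : Type*} [NormedAddCommGroup E] [InnerProductSpace ℝ E] [CompleteSpace E]
  [SecondCountableTopology E] [MeasurableSpace E] [BorelSpace E]

lemma measurePreserving_eval_eval (hν : ∀ u b, MeasurePreserving (fun y : ℕ → S => y b) (ν u) μ)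
    (u a : ℕ) :
    MeasurePreserving (fun w : ℕ → ℕ → S => w u a) (Measure.infinitePi ν) μ :=
  (hν u a).comp (measurePreserving_eval_infinitePi ν u)

lemma lintegral_pair (hν : ∀ u b, MeasurePreserving (fun y : ℕ → S => y b) (ν u) μ)
    {u v : ℕ} (huv : u ≠ v) (a b : ℕ) {f : S × S → ℝ≥0∞} (hf : Measurable f) :
    ∫⁻ w, f (w u a, w v b) ∂(Measure.infinitePi ν) = ∫⁻ p, f p ∂(μ.prod μ) := by
  rw [lintegral_update ν v (by fun_prop), lintegral_prod _ hf.aemeasurable]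
  have h1 : ∀ x : S, ∫⁻ y, f (x, y b) ∂(ν v) = ∫⁻ z, f (x, z) ∂μ := fun x =>
    (hν v b).lintegral_comp (f := fun z => f (x, z)) (by fun_prop)
  simp only [Function.update_self, Function.update_of_ne huv, h1]
  exact (measurePreserving_eval_eval hν u a).lintegral_comp
    (f := fun x => ∫⁻ z, f (x, z) ∂μ) hf.lintegral_prod_right'

/-- A bounded measurable kernel which is degenerate in each variable. -/
structure IsBddDegenerate (μ : Measure S) (g : S → S → E) : Prop where
  bddMeas : BddMeas (Function.uncurry g)
  integral_fst : ∀ y, ∫ x, g x y ∂μ = 0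
  integral_snd : ∀ x, ∫ y, g x y ∂μ = 0

variable {g : S → S → E}

namespace IsBddDegenerate

lemma bddMeas_comp {α : Type*} [MeasurableSpace α] (hg : IsBddDegenerate μ g) {f f' : α → S}
    (hf : Measurable f) (hf' : Measurable f') : BddMeas (fun x => g (f x) (f' x)) :=
  hg.bddMeas.comp (hf.prodMk hf')

lemma isMartDiff_fst (hg : IsBddDegenerate μ g)
    (hν : ∀ u b, MeasurePreserving (fun y : ℕ → S => y b) (ν u) μ) (c : ℕ → ℝ) (a : ℕ) (z : S) :
    IsMartDiff ν (fun u (w : ℕ → ℕ → S) => c u • g (w u a) z) where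
  bddMeas u := (BddMeas.const _).smul (hg.bddMeas_comp (by fun_prop) (by fun_prop))
  dependsOn u x y h := by simp only [h u (by simp)]
  centered u w := by
    simp only [Function.update_self]
    rw [integral_smul]
    have h := (hν u a).map_eq
    have h2 := hg.integral_fst z
    rw [← h, integral_map (hν u a).aemeasurable] at h2
    · rw [h2, smul_zero]
    · exact (hg.bddMeas_comp measurable_id measurable_const).1.aestronglyMeasurable

/-- Every term of row `v` pairs block `v` with an earlier block, so degeneracy in the second
variable centres the row. -/
lemma isMartDiff_snd (hg : IsBddDegenerate μ g)
    (hν : ∀ u b, MeasurePreserving (fun y : ℕ → S => y b) (ν u) μ) (c : ℕ → ℕ → ℝ) (a b : ℕ) :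
    IsMartDiff ν (fun v (w : ℕ → ℕ → S) =>
      ∑ u ∈ Finset.range v, c u v • g (w u a) (w v b)) where
  bddMeas v := BddMeas.sum _ fun u _ =>
    (BddMeas.const _).smul (hg.bddMeas_comp (by fun_prop) (by fun_prop))
  dependsOn v x y h := by
    refine Finset.sum_congr rfl fun u hu => ?_
    have := Finset.mem_range.1 hu
    rw [h u (by simp; omega), h v (by simp)]
  centered v w := by
    have h0 : ∀ y, ∑ u ∈ Finset.range v, c u v • g (Function.update w v y u a)
        (Function.update w v y v b) = ∑ u ∈ Finset.range v, c u v • g (w u a) (y b) := fun y =>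
      Finset.sum_congr rfl fun u hu => by
        rw [Function.update_self, Function.update_of_ne (Finset.mem_range.1 hu).ne]
    simp_rw [h0]
    rw [integral_finsetSum]
    · refine Finset.sum_eq_zero fun u _ => ?_
      have h2 := hg.integral_snd (w u a)
      rw [← (hν v b).map_eq, integral_map (hν v b).aemeasurable] at h2
      · rw [integral_smul, h2, smul_zero]
      · exact (hg.bddMeas_comp measurable_const measurable_id).1.aestronglyMeasurable
    · exact fun u _ => ((BddMeas.const _).smul
        (hg.bddMeas_comp measurable_const (measurable_pi_apply b))).integrable _

lemma moment_fst_le (hg : IsBddDegenerate μ g)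
    (hν : ∀ u b, MeasurePreserving (fun y : ℕ → S => y b) (ν u) μ) {c : ℕ → ℝ}
    (hc : ∀ u, |c u| ≤ 1) (a : ℕ) (z : S) {r : ℝ} (hr : 2 ≤ r) {v n : ℕ} (hv : v ≤ n) :
    ∫ w, ‖∑ u ∈ Finset.range v, c u • g (w u a) z‖ ^ r ∂(Measure.infinitePi ν) ≤
      momentConst r * (n : ℝ) ^ (r / 2) * ∫ x, ‖g x z‖ ^ r ∂μ := by
  have hK := momentConst_pos hr
  have hG : 0 ≤ ∫ x, ‖g x z‖ ^ r ∂μ := integral_nonneg fun x => by positivity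
  have hgz : BddMeas (fun x => g x z) := hg.bddMeas_comp measurable_id measurable_const
  rcases Nat.eq_zero_or_pos v with rfl | hv0
  · simp only [Finset.range_zero, Finset.sum_empty, norm_zero,
      Real.zero_rpow (by linarith : r ≠ 0), integral_zero]
    positivity
  · refine ((hg.isMartDiff_fst hν c a z).moment_le hr hv0
      (A := ∫ x, ‖g x z‖ ^ r ∂μ) fun u _ => ?_).trans ?_
    · have hp := measurePreserving_eval_eval hν u a
      rw [← hp.map_eq, integral_map hp.aemeasurable
        (hgz.norm_rpow (by linarith)).1.aestronglyMeasurable]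
      refine integral_mono (((BddMeas.const _).smul (hgz.comp hp.measurable)).norm_rpow
        (by linarith) |>.integrable _) (((hgz.comp hp.measurable).norm_rpow
        (by linarith)).integrable _) fun w => ?_
      refine Real.rpow_le_rpow (norm_nonneg _) ?_ (by linarith)
      rw [norm_smul]
      exact mul_le_of_le_one_left (norm_nonneg _) (hc u)
    · gcongr

/-- The maximal inequality in `v` costs `n ^ (r/2)`. Freezing block `v`, the row is a martingale in
`u`, and `moment_fst_le` costs a second `n ^ (r/2)`. -/
lemma maximal_moment_le (hg : IsBddDegenerate μ g)
    (hν : ∀ u b, MeasurePreserving (fun y : ℕ → S => y b) (ν u) μ) {c : ℕ → ℕ → ℝ}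
    (hc : ∀ u v, |c u v| ≤ 1) (a b : ℕ) {r : ℝ} (hr : 2 ≤ r) {n : ℕ} (hn : 0 < n) :
    ∫ w, partialSups (fun j => ‖∑ v ∈ Finset.range j, ∑ u ∈ Finset.range v,
        c u v • g (w u a) (w v b)‖) n ^ r ∂(Measure.infinitePi ν) ≤
      2 ^ r * momentConst r ^ 2 * (n : ℝ) ^ r * ∫ z, ∫ x, ‖g x z‖ ^ r ∂μ ∂μ := by
  have hgr := hg.bddMeas.norm_rpow (p := r) (by linarith)
  have hG : Measurable fun z => ∫ x, ‖g x z‖ ^ r ∂μ :=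
    (StronglyMeasurable.integral_prod_left hgr.1.stronglyMeasurable).measurable
  have hGb : BddMeas fun z => ∫ x, ‖g x z‖ ^ r ∂μ := by
    obtain ⟨-, C, hC⟩ := hgr
    refine ⟨hG, C, fun z => ?_⟩
    simpa using norm_integral_le_of_norm_le_const (μ := μ) (f := fun x => ‖g x z‖ ^ r)
      (Filter.Eventually.of_forall fun x => hC (x, z))
  refine ((hg.isMartDiff_snd hν c a b).maximal_moment_le hr hn
    (A := momentConst r * (n : ℝ) ^ (r / 2) * ∫ z, ∫ x, ‖g x z‖ ^ r ∂μ ∂μ)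
    fun v hv => ?_).trans (le_of_eq ?_)
  · have hb : BddMeas (fun p : (ℕ → ℕ → S) × (ℕ → S) =>
        ‖∑ u ∈ Finset.range v, c u v • g (p.1 u a) (p.2 b)‖ ^ r) :=
      (BddMeas.sum _ fun u _ => (BddMeas.const _).smul
        (hg.bddMeas_comp (by fun_prop) (by fun_prop))).norm_rpow (by linarith)
    rw [integral_update ν v
      (((hg.isMartDiff_snd hν c a b).bddMeas v).norm_rpow (by linarith))]
    have h0 : ∀ (w : ℕ → ℕ → S) y, ∑ u ∈ Finset.range v, c u v • g (Function.update w v y u a)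
        (Function.update w v y v b) = ∑ u ∈ Finset.range v, c u v • g (w u a) (y b) :=
      fun w y => Finset.sum_congr rfl fun u hu => by
        rw [Function.update_self, Function.update_of_ne (Finset.mem_range.1 hu).ne]
    simp_rw [h0]
    rw [integral_integral_swap (hb.integrable _)]
    have hp := hν v b
    have e : ∫ z, ∫ x, ‖g x z‖ ^ r ∂μ ∂μ = ∫ y, ∫ x, ‖g x (y b)‖ ^ r ∂μ ∂(ν v) := by
      conv_lhs => rw [← hp.map_eq]
      rw [integral_map hp.aemeasurable]
      · rw [hp.map_eq]
      · rw [hp.map_eq]; exact hG.aestronglyMeasurable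
    rw [e, ← integral_const_mul]
    refine integral_mono (hb.integrable _).integral_prod_right
      (((BddMeas.const _).mul (hGb.comp hp.measurable)).integrable _) fun y => ?_
    exact hg.moment_fst_le hν (fun u => hc u v) a (y b) hr hv.le
  · have : (n : ℝ) ^ r = (n : ℝ) ^ (r / 2) * (n : ℝ) ^ (r / 2) := by
      rw [← Real.rpow_add (by positivity)]; congr 1; ring
    rw [this]; ring

end IsBddDegenerate

end Kernel

/-! ### Comparison of joint laws with product laws -/

section Comparison

variable {T₁ T₂ : Type*} [MeasurableSpace T₁] [MeasurableSpace T₂]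

/-- Finite unions of cells of a finite measurable grid of a product space. -/
def gridSets (T₁ T₂ : Type*) [MeasurableSpace T₁] [MeasurableSpace T₂] : Set (Set (T₁ × T₂)) :=
  {A | ∃ (I J : ℕ) (f : T₁ → Fin I) (g : T₂ → Fin J) (C : Finset (Fin I × Fin J)),
    Measurable f ∧ Measurable g ∧ A = (fun p : T₁ × T₂ => (f p.1, g p.2)) ⁻¹' C}

lemma isSetAlgebra_gridSets : IsSetAlgebra (gridSets T₁ T₂) where
  empty_mem := ⟨1, 1, fun _ => 0, fun _ => 0, ∅, measurable_const, measurable_const, by simp⟩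
  compl_mem := by
    rintro _ ⟨I, J, f, g, C, hf, hg, rfl⟩
    exact ⟨I, J, f, g, Cᶜ, hf, hg, by simp⟩
  union_mem := by
    rintro _ _ ⟨I, J, f, g, C, hf, hg, rfl⟩ ⟨I', J', f', g', C', hf', hg', rfl⟩
    -- The union lives on the common refinement of the two grids.
    refine ⟨I * I', J * J', fun x => finProdFinEquiv (f x, f' x),
      fun y => finProdFinEquiv (g y, g' y),
      Finset.univ.filter fun p => ((finProdFinEquiv.symm p.1).1, (finProdFinEquiv.symm p.2).1) ∈ C ∨
        ((finProdFinEquiv.symm p.1).2, (finProdFinEquiv.symm p.2).2) ∈ C',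
      (measurable_of_finite _).comp (hf.prodMk hf'), (measurable_of_finite _).comp (hg.prodMk hg'),
      ?_⟩
    ext p
    simp [-finProdFinEquiv_symm_apply]

lemma measurableSet_of_mem_gridSets {A : Set (T₁ × T₂)} (hA : A ∈ gridSets T₁ T₂) :
    MeasurableSet A := by
  obtain ⟨I, J, f, g, C, hf, hg, rfl⟩ := hA
  exact ((hf.comp measurable_fst).prodMk (hg.comp measurable_snd)) (Finset.measurableSet C)

lemma generateFrom_gridSets :
    (inferInstance : MeasurableSpace (T₁ × T₂)) = MeasurableSpace.generateFrom (gridSets T₁ T₂) := by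
  classical
  refine le_antisymm ?_ (MeasurableSpace.generateFrom_le fun _ h => measurableSet_of_mem_gridSets h)
  rw [show (inferInstance : MeasurableSpace (T₁ × T₂)) = Prod.instMeasurableSpace from rfl,
    ← generateFrom_prod]
  refine MeasurableSpace.generateFrom_mono ?_
  rintro _ ⟨s, hs, t, ht, rfl⟩
  -- A measurable rectangle is one cell of a two-by-two grid.
  refine ⟨2, 2, fun x => if x ∈ s then 1 else 0, fun y => if y ∈ t then 1 else 0, {(1, 1)},
    Measurable.ite hs measurable_const measurable_const,
    Measurable.ite ht measurable_const measurable_const, ?_⟩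
  ext ⟨x, y⟩
  by_cases hx : x ∈ s <;> by_cases hy : y ∈ t <;> simp [hx, hy]

variable {Ω : Type*} {m₁ m₂ : MeasurableSpace Ω} [mΩ : MeasurableSpace Ω] {P : Measure Ω}
  [IsProbabilityMeasure P]

lemma isFinPartition_preimage {m : MeasurableSpace Ω} {I : ℕ} {f : Ω → Fin I}
    (hf : Measurable[m] f) : IsFinPartition m fun i => f ⁻¹' {i} := by
  refine ⟨fun i => hf (measurableSet_singleton i), fun i j hij => ?_, ?_⟩
  · exact Disjoint.preimage _ (by simpa using hij)
  · ext x; simp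

lemma two_mul_betaCoeff_ge {I J : ℕ} {A : Fin I → Set Ω}
    {B : Fin J → Set Ω} (hA : IsFinPartition m₁ A) (hB : IsFinPartition m₂ B) :
    ∑ i, ∑ j, ENNReal.ofReal |P.real (A i ∩ B j) - P.real (A i) * P.real (B j)| ≤
      2 * betaCoeff P m₁ m₂ := by
  rw [betaCoeff, ← mul_assoc, ENNReal.mul_inv_cancel (by simp) (by simp), one_mul]
  exact le_iSup_of_le I <| le_iSup_of_le J <| le_iSup_of_le A <| le_iSup_of_le B <|
    le_iSup_of_le hA <| le_iSup_of_le hB le_rfl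

lemma measure_inter_le_mul_add (A B : Set Ω) :
    P (A ∩ B) ≤ P A * P B + ENNReal.ofReal |P.real (A ∩ B) - P.real A * P.real B| := by
  rw [← ofReal_measureReal (μ := P) (s := A ∩ B), ← ofReal_measureReal (μ := P) (s := A),
    ← ofReal_measureReal (μ := P) (s := B), ← ENNReal.ofReal_mul measureReal_nonneg,
    ← ENNReal.ofReal_add (by positivity) (abs_nonneg _)]
  refine ENNReal.ofReal_le_ofReal ?_
  linarith [le_abs_self (P.real (A ∩ B) - P.real A * P.real B)]

/-- Summing the defects over the chosen cells, and then over all cells, gives one of the sums in the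
supremum defining `betaCoeff`. The factor 2 undoes its normalisation by one half. -/
lemma measure_pair_le_of_mem_gridSets (h₁ : m₁ ≤ mΩ) (h₂ : m₂ ≤ mΩ)
    {U : Ω → T₁} {V : Ω → T₂} (hU : Measurable[m₁] U) (hV : Measurable[m₂] V)
    {A : Set (T₁ × T₂)} (hA : A ∈ gridSets T₁ T₂) :
    (P.map fun ω => (U ω, V ω)) A ≤ ((P.map U).prod (P.map V)) A + 2 * betaCoeff P m₁ m₂ := by
  have hU' : Measurable U := hU.mono h₁ le_rfl
  have hV' : Measurable V := hV.mono h₂ le_rfl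
  obtain ⟨I, J, f, g, C, hf, hg, rfl⟩ := hA
  have hF : Measurable fun p : T₁ × T₂ => (f p.1, g p.2) :=
    (hf.comp measurable_fst).prodMk (hg.comp measurable_snd)
  have hcell : ∀ c ∈ C, (P.map fun ω => (U ω, V ω))
      ((fun p : T₁ × T₂ => (f p.1, g p.2)) ⁻¹' {c}) ≤
      ((P.map U).prod (P.map V)) ((fun p : T₁ × T₂ => (f p.1, g p.2)) ⁻¹' {c}) +
        ENNReal.ofReal |P.real ((fun ω => f (U ω)) ⁻¹' {c.1} ∩ (fun ω => g (V ω)) ⁻¹' {c.2}) -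
          P.real ((fun ω => f (U ω)) ⁻¹' {c.1}) * P.real ((fun ω => g (V ω)) ⁻¹' {c.2})| := by
    rintro ⟨i, j⟩ -
    have e : (fun p : T₁ × T₂ => (f p.1, g p.2)) ⁻¹' {(i, j)} = (f ⁻¹' {i}) ×ˢ (g ⁻¹' {j}) := by
      ext p; simp
    rw [e, Measure.map_apply (hU'.prodMk hV') ((hf (measurableSet_singleton i)).prod
      (hg (measurableSet_singleton j))), Measure.prod_prod,
      Measure.map_apply hU' (hf (measurableSet_singleton i)),
      Measure.map_apply hV' (hg (measurableSet_singleton j))]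
    have e2 : (fun ω => (U ω, V ω)) ⁻¹' (f ⁻¹' {i}) ×ˢ (g ⁻¹' {j}) =
        (fun ω => f (U ω)) ⁻¹' {i} ∩ (fun ω => g (V ω)) ⁻¹' {j} := by
      ext ω; simp
    rw [e2]
    change P _ ≤ P ((fun ω => f (U ω)) ⁻¹' {i}) * P ((fun ω => g (V ω)) ⁻¹' {j}) + _
    exact measure_inter_le_mul_add _ _
  rw [← sum_measure_preimage_singleton C fun c _ => hF (measurableSet_singleton c),
    ← sum_measure_preimage_singleton C fun c _ => hF (measurableSet_singleton c)]
  refine (Finset.sum_le_sum hcell).trans ?_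
  rw [Finset.sum_add_distrib]
  gcongr
  refine (Finset.sum_le_univ_sum_of_nonneg fun _ => zero_le).trans ?_
  have hfU : Measurable[m₁] fun ω => f (U ω) := hf.comp hU
  have hgV : Measurable[m₂] fun ω => g (V ω) := hg.comp hV
  have hβ := two_mul_betaCoeff_ge (P := P) (isFinPartition_preimage hfU)
    (isFinPartition_preimage hgV)
  rwa [← Fintype.sum_prod_type'] at hβ

/-- The joint law of two random variables differs from the product of the laws by at most twice
the `β`-mixing coefficient. -/
lemma measure_pair_le (h₁ : m₁ ≤ mΩ) (h₂ : m₂ ≤ mΩ)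
    {U : Ω → T₁} {V : Ω → T₂} (hU : Measurable[m₁] U) (hV : Measurable[m₂] V)
    {A : Set (T₁ × T₂)} (hA : MeasurableSet A) :
    (P.map fun ω => (U ω, V ω)) A ≤ ((P.map U).prod (P.map V)) A + 2 * betaCoeff P m₁ m₂ := by
  have hU' : Measurable U := hU.mono h₁ le_rfl
  have hV' : Measurable V := hV.mono h₂ le_rfl
  have := Measure.isProbabilityMeasure_map (μ := P) hU'.aemeasurable
  have := Measure.isProbabilityMeasure_map (μ := P) hV'.aemeasurable
  have := Measure.isProbabilityMeasure_map (μ := P) (hU'.prodMk hV').aemeasurable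
  set ρ₁ := P.map fun ω => (U ω, V ω)
  set ρ₂ := (P.map U).prod (P.map V)
  -- Density for the sum of the two laws provides one grid set approximating `A` under both.
  have hd : (ρ₁ + ρ₂).MeasureDense (gridSets T₁ T₂) :=
    Measure.MeasureDense.of_generateFrom_isSetAlgebra_finite _ isSetAlgebra_gridSets
      generateFrom_gridSets
  refine ENNReal.le_of_forall_pos_le_add fun ε hε _ => ?_
  obtain ⟨B, hB, hAB⟩ := hd.approx A hA (measure_ne_top _ _) (ε / 2 : ℝ) (by positivity)
  have hε2 : ENNReal.ofReal (ε / 2 : ℝ) = (ε : ℝ≥0∞) / 2 := by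
    rw [ENNReal.ofReal_div_of_pos two_pos]; simp
  rw [hε2, Measure.add_apply] at hAB
  have hle : ∀ {ρ : Measure (T₁ × T₂)} {s t : Set (T₁ × T₂)},
      ρ s ≤ ρ t + ρ (symmDiff s t) := fun {ρ s t} => by
    refine (measure_mono ?_).trans (measure_union_le t (symmDiff s t))
    intro x hx
    by_cases hxt : x ∈ t
    · exact Or.inl hxt
    · exact Or.inr (Or.inl ⟨hx, hxt⟩)
  have h1 : ρ₁ (symmDiff A B) ≤ (ε : ℝ≥0∞) / 2 := (le_self_add.trans hAB.le)
  have h2 : ρ₂ (symmDiff B A) ≤ (ε : ℝ≥0∞) / 2 := by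
    rw [symmDiff_comm]; exact le_add_self.trans hAB.le
  calc ρ₁ A ≤ ρ₁ B + ε / 2 := hle.trans (by gcongr)
    _ ≤ ρ₂ B + 2 * betaCoeff P m₁ m₂ + ε / 2 := by
        gcongr; exact measure_pair_le_of_mem_gridSets h₁ h₂ hU hV hB
    _ ≤ ρ₂ A + ε / 2 + 2 * betaCoeff P m₁ m₂ + ε / 2 := by
        gcongr; exact hle.trans (by gcongr)
    _ = ρ₂ A + 2 * betaCoeff P m₁ m₂ + (ε / 2 + ε / 2) := by ring
    _ = _ := by rw [ENNReal.add_halves]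

end Comparison

/-! ### Replacing blocks by independent ones -/

section Hybrid

variable {Ω T : Type*} [MeasurableSpace Ω] [MeasurableSpace T] {P : Measure Ω}
  [IsProbabilityMeasure P]

/-- The sequence whose first `k` terms are those of `x` and whose other terms are those of `y`. -/
def splice (k : ℕ) (x y : ℕ → T) (u : ℕ) : T := if u < k then x u else y u

lemma measurable_splice {α : Type*} [MeasurableSpace α] (k : ℕ) {f g : α → ℕ → T}
    (hf : Measurable f) (hg : Measurable g) : Measurable fun a => splice k (f a) (g a) := by
  refine measurable_pi_lambda _ fun u => ?_
  unfold splice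
  split_ifs
  · exact (measurable_pi_apply u).comp hf
  · exact (measurable_pi_apply u).comp hg

/-- Shows that the sequence with `k + 1` original terms depends on `x` only through its first `k`
terms (padded by `t`) and its term `k`, the pair whose joint law is compared with a product. -/
lemma splice_succ (k : ℕ) (x y t : ℕ → T) :
    splice (k + 1) x y = splice k (splice k x t) (Function.update y k (x k)) := by
  funext u
  unfold splice
  rcases lt_trichotomy u k with h | rfl | h
  · simp [h, h.trans (Nat.lt_succ_self k)]
  · simp
  · simp [h.not_gt, h.ne', not_lt.2 (Nat.succ_le_of_lt h)]

lemma splice_splice (k : ℕ) (x y t : ℕ → T) : splice k (splice k x t) y = splice k x y := by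
  funext u
  unfold splice
  split_ifs <;> rfl

/-- Hybrid argument: lowering the number of original terms from `k + 1` to `k` replaces term `k` by
an independent copy, at cost `ε k`. -/
lemma measure_splice_le {W : Ω → ℕ → T} (hW : Measurable W) (t : ℕ → T) (ε : ℕ → ℝ≥0∞)
    (hε : ∀ k (A : Set ((ℕ → T) × T)), MeasurableSet A →
      (P.map fun ω => (splice k (W ω) t, W ω k)) A ≤
        ((P.map fun ω => splice k (W ω) t).prod (P.map fun ω => W ω k)) A + ε k)
    {A : Set (ℕ → T)} (hA : MeasurableSet A) (k : ℕ) :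
    (P.prod (Measure.infinitePi fun u => P.map fun ω => W ω u))
        {p | splice k (W p.1) p.2 ∈ A} ≤
      (Measure.infinitePi fun u => P.map fun ω => W ω u) A + ∑ i ∈ Finset.range k, ε i := by
  have hWu : ∀ u, Measurable fun ω => W ω u := fun u => (measurable_pi_apply u).comp hW
  have : ∀ u, IsProbabilityMeasure (P.map fun ω => W ω u) := fun u =>
    Measure.isProbabilityMeasure_map (hWu u).aemeasurable
  set Q := Measure.infinitePi fun u => P.map fun ω => W ω u with hQ
  have hms : ∀ k, MeasurableSet {p : Ω × (ℕ → T) | splice k (W p.1) p.2 ∈ A} := fun k =>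
    measurable_splice k (hW.comp measurable_fst) measurable_snd hA
  induction k with
  | zero =>
    have : {p : Ω × (ℕ → T) | splice 0 (W p.1) p.2 ∈ A} = Set.univ ×ˢ A := by
      ext p
      have : splice 0 (W p.1) p.2 = p.2 := by funext u; simp [splice]
      simp [this]
    rw [this, Measure.prod_prod]
    simp
  | succ k ih =>
    rw [Finset.sum_range_succ, ← add_assoc]
    refine le_trans ?_ (add_le_add_left ih (ε k))
    have hpast : Measurable fun ω => splice k (W ω) t := measurable_splice k hW measurable_const
    have := Measure.isProbabilityMeasure_map (μ := P) hpast.aemeasurable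
    have hsec : ∀ w : ℕ → T, MeasurableSet
        {p : (ℕ → T) × T | splice k p.1 (Function.update w k p.2) ∈ A} := fun w =>
      measurable_splice k measurable_fst ((measurable_update w).comp measurable_snd) hA
    have hφ : Measurable fun w => P {ω | splice k (W ω) w ∈ A} :=
      measurable_measure_prodMk_right (hms k)
    rw [Measure.prod_apply_symm (hms (k + 1)), Measure.prod_apply_symm (hms k)]
    change ∫⁻ w, P {ω | splice (k + 1) (W ω) w ∈ A} ∂Q ≤
      ∫⁻ w, P {ω | splice k (W ω) w ∈ A} ∂Q + ε k
    -- Resampling coordinate `k` of the independent sequence makes the fresh copy explicit; the two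
    -- sides then differ only in the entry at `k`.
    rw [hQ, lintegral_update _ k hφ, ← hQ]
    have hstep : ∀ w, P {ω | splice (k + 1) (W ω) w ∈ A} ≤
        ∫⁻ y, P {ω | splice k (W ω) (Function.update w k y) ∈ A} ∂(P.map fun ω => W ω k) + ε k := by
      intro w
      have h := hε k _ (hsec w)
      rw [Measure.map_apply (hpast.prodMk (hWu k)) (hsec w), Measure.prod_apply_symm (hsec w)] at h
      refine le_trans (le_of_eq ?_) (h.trans (add_le_add_left (le_of_eq ?_) _))
      · congr 1; ext ω
        simp only [Set.mem_ofPred_eq, Set.mem_preimage, splice_succ k (W ω) w t]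
      · refine lintegral_congr fun y => ?_
        have hm : MeasurableSet ((fun x : ℕ → T => (x, y)) ⁻¹'
            {p : (ℕ → T) × T | splice k p.1 (Function.update w k p.2) ∈ A}) :=
          measurable_prodMk_right (hsec w)
        rw [Measure.map_apply hpast hm]
        congr 1; ext ω
        simp only [Set.mem_ofPred_eq, Set.mem_preimage, splice_splice]
    refine (lintegral_mono hstep).trans (le_of_eq ?_)
    rw [lintegral_add_right _ measurable_const, lintegral_const, measure_univ, mul_one]

lemma measure_block_le {W : Ω → ℕ → T} (hW : Measurable W) (t : ℕ → T) (ε : ℕ → ℝ≥0∞)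
    (hε : ∀ k (A : Set ((ℕ → T) × T)), MeasurableSet A →
      (P.map fun ω => (splice k (W ω) t, W ω k)) A ≤
        ((P.map fun ω => splice k (W ω) t).prod (P.map fun ω => W ω k)) A + ε k)
    {A : Set (ℕ → T)} (hA : MeasurableSet A) (m : ℕ) (hAm : DependsOn (· ∈ A) (Set.Iio m)) :
    P {ω | W ω ∈ A} ≤
      (Measure.infinitePi fun u => P.map fun ω => W ω u) A + ∑ i ∈ Finset.range m, ε i := by
  have : ∀ u, IsProbabilityMeasure (P.map fun ω => W ω u) := fun u =>
    Measure.isProbabilityMeasure_map ((measurable_pi_apply u).comp hW).aemeasurable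
  refine le_trans (le_of_eq ?_) (measure_splice_le hW t ε hε hA m)
  have : {p : Ω × (ℕ → T) | splice m (W p.1) p.2 ∈ A} = {ω | W ω ∈ A} ×ˢ Set.univ := by
    ext p
    have h : (splice m (W p.1) p.2 ∈ A) = (W p.1 ∈ A) := hAm fun i hi => by
      simp [splice, Set.mem_Iio.1 hi]
    simp [h]
  rw [this, Measure.prod_prod, measure_univ, mul_one]

end Hybrid

/-! ### Blocks of a stationary sequence -/

section Blocks

/-- A form of `measurable_pi_lambda` for `σ`-algebras which are not instances. -/
lemma measurable_pi_of_forall {α ι β : Type*} {m : MeasurableSpace α} [MeasurableSpace β]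
    {f : α → ι → β} (hf : ∀ i, Measurable[m] fun a => f a i) : Measurable[m] f :=
  measurable_pi_lambda _ hf

lemma measurable_sigmaGen {Ω S : Type*} [MeasurableSpace S] {X : ℕ → Ω → S} {s : Set ℕ} {i : ℕ} (hi : i ∈ s) :
    Measurable[sigmaGen X s] (X i) := by
  refine Measurable.mono (comap_measurable (X i)) ?_ le_rfl
  exact le_iSup₂ (f := fun i (_ : i ∈ s) => MeasurableSpace.comap (X i) _) i hi

variable {Ω S : Type*} [MeasurableSpace Ω] [MeasurableSpace S] {P : Measure Ω}
  [IsProbabilityMeasure P] {X : ℕ → Ω → S}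

/-- The `b`-th index of the `u`-th block, the blocks of length `2 * q` being separated by gaps of
length `q` and the whole picture being shifted to the left by `s * q`. -/
def blockIdx (q s u b : ℕ) : ℕ := 3 * q * u + min b (2 * q - 1) - s * q

/-- The sequence of blocks of the sequence `X 1, X 2, …`. -/
def block (X : ℕ → Ω → S) (q s : ℕ) (ω : Ω) (u b : ℕ) : S := X (blockIdx q s u b + 1) ω

lemma StrictlyStationary.measurable_block (hX : StrictlyStationary P X) (q s : ℕ) :
    Measurable (block X q s) :=
  measurable_pi_lambda _ fun _ => measurable_pi_lambda _ fun _ => hX.1 _ (by omega)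

lemma StrictlyStationary.map_pair (hX : StrictlyStationary P X) (i k : ℕ) :
    P.map (fun ω => (X (i + 1) ω, X (i + k + 1) ω)) = P.map (fun ω => (X 1 ω, X (k + 1) ω)) := by
  have hm : ∀ l : ℕ, Measurable fun ω (j : ℕ) => X (j + 1 + l) ω := fun l =>
    measurable_pi_lambda _ fun j => hX.1 _ (by omega)
  have hp : Measurable fun x : ℕ → S => (x 0, x k) := by fun_prop
  have h := congrArg (Measure.map fun x : ℕ → S => (x 0, x k)) (hX.2 i)
  rw [Measure.map_map hp (hm i), Measure.map_map hp (hm 0)] at h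
  convert h using 2
  · funext ω
    simp only [Function.comp_apply]
    congr 2 <;> omega
  · rfl

lemma StrictlyStationary.measurePreserving (hX : StrictlyStationary P X) (i : ℕ) :
    MeasurePreserving (X (i + 1)) P (P.map (X 1)) := by
  refine ⟨hX.1 _ (by omega), ?_⟩
  have h := congrArg (Measure.map Prod.fst) (hX.map_pair i 0)
  rwa [Measure.map_map measurable_fst ((hX.1 _ (by omega)).prodMk (hX.1 _ (by omega))),
    Measure.map_map measurable_fst ((hX.1 _ (by omega)).prodMk (hX.1 _ (by omega)))] at h

lemma StrictlyStationary.measurePreserving_block (hX : StrictlyStationary P X) (q s u b : ℕ) :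
    MeasurePreserving (fun y : ℕ → S => y b) (P.map fun ω => block X q s ω u) (P.map (X 1)) := by
  refine ⟨measurable_pi_apply b, ?_⟩
  have hu : Measurable fun ω => block X q s ω u :=
    (measurable_pi_apply u).comp (hX.measurable_block q s)
  rw [Measure.map_map (measurable_pi_apply b) hu]
  exact (hX.measurePreserving _).map_eq

/-- As `s * q ≤ 2 * q`, truncated subtraction can clip only block 0, and clipping there does not
shorten the gap below `q`. -/
lemma blockIdx_gap {q s u k b b' : ℕ} (hq : 1 ≤ q) (hs : s ≤ 2) (hu : u ≤ k) :
    blockIdx q s u b + 1 + q ≤ blockIdx q s (k + 1) b' + 1 := by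
  unfold blockIdx
  have h1 : 3 * q * u ≤ 3 * q * k := by gcongr
  have h2 : 3 * q * (k + 1) = 3 * q * k + 3 * q := by ring
  have h3 : s * q ≤ 2 * q := by gcongr
  have h4 : s = 0 ∨ s = 1 ∨ s = 2 := by omega
  rw [h2]
  rcases h4 with rfl | rfl | rfl <;> omega

lemma StrictlyStationary.sigmaGen_le (hX : StrictlyStationary P X) {s : Set ℕ}
    (hs : ∀ i ∈ s, 1 ≤ i) : sigmaGen X s ≤ (inferInstance : MeasurableSpace Ω) :=
  iSup₂_le fun i hi => (hX.1 i (hs i hi)).comap_le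

/-- Replacing the blocks of `X` by independent blocks with the same laws. -/
lemma StrictlyStationary.measure_block_le (hX : StrictlyStationary P X) {q s : ℕ} (hq : 1 ≤ q)
    (hs : s ≤ 2) {A : Set (ℕ → ℕ → S)} (hA : MeasurableSet A) (m : ℕ)
    (hAm : DependsOn (· ∈ A) (Set.Iio (m + 1))) :
    P {ω | block X q s ω ∈ A} ≤
      (Measure.infinitePi fun u => P.map fun ω => block X q s ω u) A +
        m * (2 * betaMixing P X q) := by
  have hW := hX.measurable_block q s
  have hWu : ∀ u, Measurable fun ω => block X q s ω u := fun u => (measurable_pi_apply u).comp hW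
  obtain ⟨ω₀⟩ : Nonempty Ω := nonempty_of_isProbabilityMeasure P
  set t : ℕ → ℕ → S := fun _ _ => X 1 ω₀
  -- Block 0 has no past, so its replacement is free and only `m` of the `m + 1` replacements are
  -- paid for.
  have h := UStatMixing.measure_block_le (P := P) hW t
    (fun k => if k = 0 then 0 else 2 * betaMixing P X q) ?_ hA (m + 1) hAm
  · refine h.trans (add_le_add_right (le_of_eq ?_) _)
    rw [Finset.sum_range_succ']
    simp
  · intro k B hB
    rcases k with _ | k
    · have h0 : ∀ x : ℕ → ℕ → S, splice 0 x t = t := fun x => by funext u; simp [splice]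
      simp only [h0, if_true, add_zero]
      have := (indepFun_iff_map_prod_eq_prod_map_map (μ := P) (f := fun _ => t)
        measurable_const.aemeasurable (hWu 0).aemeasurable).1 (indepFun_const_left t _)
      rw [this]
    -- The time of the last entry of block `k`; block `k + 1` starts at time `ℓ + q` or later.
    · set ℓ := 3 * q * k + (2 * q - 1) - s * q + 1 with hℓ
      have hpast : Measurable[sigmaGen X (Set.Icc 1 ℓ)]
          fun ω => splice (k + 1) (block X q s ω) t := by
        refine measurable_pi_of_forall fun u => ?_
        unfold splice
        split_ifs with hu
        · refine measurable_pi_of_forall fun b => measurable_sigmaGen ⟨by omega, ?_⟩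
          have h1 : 3 * q * u ≤ 3 * q * k := Nat.mul_le_mul_left _ (by omega)
          unfold blockIdx
          omega
        · exact measurable_const
      have hfut : Measurable[sigmaGen X (Set.Ici (ℓ + q))] fun ω => block X q s ω (k + 1) := by
        refine measurable_pi_of_forall fun b => measurable_sigmaGen ?_
        have := blockIdx_gap (u := k) (k := k) (b := 2 * q - 1) (b' := b) hq hs le_rfl
        simp only [Set.mem_Ici]
        refine le_trans (le_of_eq ?_) this
        simp [hℓ, blockIdx]
      refine (measure_pair_le (hX.sigmaGen_le fun i hi => hi.1)
        (hX.sigmaGen_le fun i hi => ?_) hpast hfut hB).trans ?_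
      · have : ℓ + q ≤ i := hi
        omega
      · simp only [Nat.add_eq_zero_iff, one_ne_zero, and_false, if_false]
        gcongr
        exact le_iSup₂ (f := fun (ℓ : ℕ) (_ : 1 ≤ ℓ) =>
          betaCoeff P (sigmaGen X (Set.Icc 1 ℓ)) (sigmaGen X (Set.Ici (ℓ + q)))) ℓ (by omega)

end Blocks

/-! ### Decomposition of the sum over pairs of indices -/

section Decomposition

/-- The index `i` lies in a block. -/
def InBlock (q s i : ℕ) : Prop := (i + s * q) % (3 * q) < 2 * q

instance (q s i : ℕ) : Decidable (InBlock q s i) := inferInstanceAs (Decidable (_ < _))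

lemma not_inBlock {q s i : ℕ} (hq : 1 ≤ q) (h : ¬ InBlock q s i) :
    ∃ t, 3 * (q * t) + 2 * q ≤ i + s * q ∧ i + s * q < 3 * (q * t) + 3 * q := by
  refine ⟨(i + s * q) / (3 * q), ?_⟩
  have h1 := Nat.div_add_mod (i + s * q) (3 * q)
  have h2 := Nat.mod_lt (i + s * q) (by omega : 0 < 3 * q)
  rw [mul_assoc] at h1
  unfold InBlock at h
  omega

/-- The gaps have length `q` and period `3q`, and different shifts move them by `q` or `2q`, so gaps
of different shifts are disjoint. -/
lemma inBlock_or {q s s' i : ℕ} (hq : 1 ≤ q) (hs : s < s') (hs' : s' ≤ 2) :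
    InBlock q s i ∨ InBlock q s' i := by
  by_contra! h
  obtain ⟨t, h1, h2⟩ := not_inBlock hq h.1
  obtain ⟨t', h3, h4⟩ := not_inBlock hq h.2
  have h5 : s * q + q ≤ s' * q := by nlinarith
  have h6 : s' * q ≤ s * q + 2 * q := by nlinarith
  rcases Nat.lt_or_ge t t' with h | h
  · have : q * (t + 1) ≤ q * t' := Nat.mul_le_mul_left _ h
    rw [mul_add] at this
    omega
  · have : q * t' ≤ q * t := Nat.mul_le_mul_left _ h
    omega

/-- A shift for which both `i` and `j` lie in a block. -/
def commonShift (q i j : ℕ) : ℕ :=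
  if InBlock q 0 i ∧ InBlock q 0 j then 0 else if InBlock q 1 i ∧ InBlock q 1 j then 1 else 2

lemma commonShift_lt (q i j : ℕ) : commonShift q i j < 3 := by
  unfold commonShift; split_ifs <;> omega

/-- Each index rules out at most one shift, so two indices leave at least one of three. -/
lemma inBlock_commonShift {q : ℕ} (hq : 1 ≤ q) (i j : ℕ) :
    InBlock q (commonShift q i j) i ∧ InBlock q (commonShift q i j) j := by
  have a1 := inBlock_or (i := i) hq (show 0 < 1 by omega) (by omega)
  have a2 := inBlock_or (i := i) hq (show 0 < 2 by omega) (by omega)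
  have a3 := inBlock_or (i := i) hq (show 1 < 2 by omega) (by omega)
  have b1 := inBlock_or (i := j) hq (show 0 < 1 by omega) (by omega)
  have b2 := inBlock_or (i := j) hq (show 0 < 2 by omega) (by omega)
  have b3 := inBlock_or (i := j) hq (show 1 < 2 by omega) (by omega)
  unfold commonShift
  split_ifs with h1 h2
  · exact h1
  · exact h2
  · tauto

/-- `i` and `j` lie in two different blocks of the shift chosen for them, `i` in the earlier. -/
def IsFar (q s i j : ℕ) : Prop :=
  commonShift q i j = s ∧ (i + s * q) / (3 * q) < (j + s * q) / (3 * q)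

instance (q s i j : ℕ) : Decidable (IsFar q s i j) := inferInstanceAs (Decidable (_ ∧ _))

lemma near_of_not_isFar {q i j : ℕ} (hq : 1 ≤ q) (hij : i < j)
    (h : ¬ IsFar q (commonShift q i j) i j) : j < i + 2 * q := by
  set s := commonShift q i j with hs
  obtain ⟨h1, h2⟩ := inBlock_commonShift hq i j
  rw [← hs] at h1 h2
  unfold InBlock at h1 h2
  have h3 : (j + s * q) / (3 * q) ≤ (i + s * q) / (3 * q) := by
    by_contra! h4
    exact h ⟨hs.symm, h4⟩
  have h5 : (i + s * q) / (3 * q) ≤ (j + s * q) / (3 * q) := Nat.div_le_div_right (by omega)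
  have h6 := Nat.div_add_mod (i + s * q) (3 * q)
  have h7 := Nat.div_add_mod (j + s * q) (3 * q)
  rw [le_antisymm h3 h5] at h7
  omega

variable {E : Type*} [NormedAddCommGroup E] [NormedSpace ℝ E]

/-- The near part is enlarged to a sum of norms up to `N`, free of `n`, so it needs no maximal
inequality; the far part keeps its cancellation. -/
lemma norm_sum_pairs_le {q : ℕ} (hq : 1 ≤ q) (f : ℕ → ℕ → E) {n N : ℕ} (hn : n ≤ N) :
    ‖∑ j ∈ Finset.range n, ∑ i ∈ Finset.range j, f i j‖ ≤
      ∑ j ∈ Finset.range N, ∑ i ∈ Finset.Ico (j + 1 - 2 * q) j, ‖f i j‖ +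
      ∑ s ∈ Finset.range 3, ‖∑ j ∈ Finset.range n, ∑ i ∈ Finset.range j,
        if IsFar q s i j then f i j else 0‖ := by
  have hdec : ∀ i j, f i j = (if IsFar q (commonShift q i j) i j then 0 else f i j) +
      ∑ s ∈ Finset.range 3, if IsFar q s i j then f i j else 0 := fun i j => by
    have h0 : ∀ s ∈ Finset.range 3, s ≠ commonShift q i j →
        (if IsFar q s i j then f i j else 0) = 0 := fun s _ hs =>
      if_neg fun h => hs h.1.symm
    rw [Finset.sum_eq_single_of_mem _ (Finset.mem_range.2 (commonShift_lt q i j)) h0]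
    split_ifs <;> simp
  have hsum : ∑ j ∈ Finset.range n, ∑ i ∈ Finset.range j, f i j =
      ∑ j ∈ Finset.range n, ∑ i ∈ Finset.range j,
        (if IsFar q (commonShift q i j) i j then 0 else f i j) +
      ∑ s ∈ Finset.range 3, ∑ j ∈ Finset.range n, ∑ i ∈ Finset.range j,
        if IsFar q s i j then f i j else 0 := by
    conv_lhs => enter [2, j, 2, i]; rw [hdec i j]
    simp_rw [Finset.sum_add_distrib]
    congr 1
    rw [Finset.sum_comm]
    refine Finset.sum_congr rfl fun j _ => ?_
    rw [Finset.sum_comm]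
  rw [hsum]
  refine (norm_add_le _ _).trans (add_le_add ?_ (norm_sum_le _ _))
  calc _ ≤ ∑ j ∈ Finset.range n, ∑ i ∈ Finset.Ico (j + 1 - 2 * q) j, ‖f i j‖ := by
        refine norm_sum_le_of_le _ fun j _ => ?_
        have hsub : Finset.Ico (j + 1 - 2 * q) j ⊆ Finset.range j := fun i hi => by
          simp at hi ⊢; omega
        rw [← Finset.sum_subset hsub]
        · refine norm_sum_le_of_le _ fun i _ => ?_
          split_ifs <;> simp
        · intro i hi hi'
          refine if_pos ?_
          by_contra h
          have := near_of_not_isFar hq (Finset.mem_range.1 hi) h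
          simp at hi hi'
          omega
    _ ≤ _ := Finset.sum_le_sum_of_subset_of_nonneg (by simpa using hn) fun _ _ _ =>
        Finset.sum_nonneg fun _ _ => norm_nonneg _

/-- Regrouping by `k = d * v + b`; the quotient counts the `k < L` with residue `b`, and only
residues below `c` contribute. -/
lemma sum_range_eq_sum_residues {F : Type*} [AddCommMonoid F] {c d : ℕ} (hc : c ≤ d) (hd : 0 < d)
    (L : ℕ) {ψ : ℕ → F} (hψ : ∀ k, c ≤ k % d → ψ k = 0) :
    ∑ k ∈ Finset.range L, ψ k =
      ∑ b ∈ Finset.range c, ∑ v ∈ Finset.range ((L + (d - 1) - b) / d), ψ (d * v + b) := by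
  have h1 : ∑ k ∈ Finset.range L, ψ k = ∑ k ∈ Finset.range L with k % d < c, ψ k := by
    rw [Finset.sum_filter]
    refine Finset.sum_congr rfl fun k _ => ?_
    split_ifs with h
    · rfl
    · exact hψ k (not_lt.1 h)
  have hlt : ∀ {b v : ℕ}, b < c → (v < (L + (d - 1) - b) / d ↔ d * v + b < L) := fun {b v} hb => by
    rw [Nat.lt_iff_add_one_le, Nat.le_div_iff_mul_le hd]
    have : (v + 1) * d = d * v + d := by ring
    rw [this]; omega
  rw [h1, Finset.sum_sigma']
  refine Finset.sum_bij' (fun k _ => ⟨k % d, k / d⟩) (fun p _ => d * p.2 + p.1) ?_ ?_ ?_ ?_ ?_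
  · intro k hk
    simp only [Finset.mem_filter, Finset.mem_range, Finset.mem_sigma] at hk ⊢
    refine ⟨hk.2, (hlt hk.2).2 ?_⟩
    rw [Nat.div_add_mod]; exact hk.1
  · rintro ⟨b, v⟩ hp
    simp only [Finset.mem_filter, Finset.mem_range, Finset.mem_sigma] at hp ⊢
    refine ⟨(hlt hp.1).1 hp.2, ?_⟩
    rw [Nat.mul_add_mod, Nat.mod_eq_of_lt (hp.1.trans_le hc)]
    exact hp.1
  · intro k _
    exact Nat.div_add_mod k d
  · rintro ⟨b, v⟩ hp
    simp only [Finset.mem_range, Finset.mem_sigma] at hp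
    have hb := hp.1.trans_le hc
    ext
    · simp [Nat.mod_eq_of_lt hb]
    · simp [Nat.mul_add_div hd, Nat.div_eq_of_lt hb]
  · intro k _
    simp only [Nat.div_add_mod]

lemma sum_range_shift {F : Type*} [AddCommMonoid F] (t n : ℕ) (φ : ℕ → F) :
    ∑ j ∈ Finset.range n, φ j =
      ∑ k ∈ Finset.range (n + t), if t ≤ k then φ (k - t) else 0 := by
  have h0 : ∑ k ∈ Finset.range t, (if t ≤ k then φ (k - t) else 0) = 0 :=
    Finset.sum_eq_zero fun k hk => if_neg (not_le.2 (Finset.mem_range.1 hk))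
  rw [add_comm n t, Finset.sum_range_add, h0, zero_add]
  simp

/-- The indicator of the pairs of block positions which occur in the sum over pairs. -/
noncomputable def pairCoeff (q s a b u v : ℕ) : ℝ :=
  if s * q ≤ 3 * q * u + a ∧ s * q ≤ 3 * q * v + b ∧
    commonShift q (3 * q * u + a - s * q) (3 * q * v + b - s * q) = s then 1 else 0

lemma abs_pairCoeff_le (q s a b u v : ℕ) : |pairCoeff q s a b u v| ≤ 1 := by
  unfold pairCoeff; split_ifs <;> simp

/-- The number of blocks whose `b`-th index is less than `n`. -/
def blockCount (q s n b : ℕ) : ℕ := (n + s * q + (3 * q - 1) - b) / (3 * q)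

/-- After the translation by `s * q`, block number and offset are quotient and remainder modulo `3 *
q`. Being far then means `u < v` with the right common shift. The inequalities in `pairCoeff`
discard positions before the start of the sequence, where truncated subtraction would create
spurious indices. -/
lemma sum_isFar_eq {q s : ℕ} (hq : 1 ≤ q) (f : ℕ → ℕ → E) (n : ℕ) :
    ∑ j ∈ Finset.range n, ∑ i ∈ Finset.range j, (if IsFar q s i j then f i j else 0) =
      ∑ b ∈ Finset.range (2 * q), ∑ a ∈ Finset.range (2 * q),
        ∑ v ∈ Finset.range (blockCount q s n b), ∑ u ∈ Finset.range v,
          pairCoeff q s a b u v • f (3 * q * u + a - s * q) (3 * q * v + b - s * q) := by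
  have hd : 0 < 3 * q := by omega
  set G : ℕ → ℕ → E := fun k l => if s * q ≤ k ∧ s * q ≤ l ∧
    IsFar q s (k - s * q) (l - s * q) then f (k - s * q) (l - s * q) else 0 with hG
  have hG0 : ∀ k l, G k l ≠ 0 → k % (3 * q) < 2 * q ∧ l % (3 * q) < 2 * q ∧
      k / (3 * q) < l / (3 * q) := by
    intro k l h
    by_contra h'
    refine h (if_neg ?_)
    rintro ⟨h1, h2, h3, h4⟩
    have h5 := inBlock_commonShift hq (k - s * q) (l - s * q)
    rw [h3] at h5
    unfold InBlock at h5
    rw [Nat.sub_add_cancel h1, Nat.sub_add_cancel h2] at *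
    exact h' ⟨h5.1, h5.2, h4⟩
  have h1 : ∑ j ∈ Finset.range n, ∑ i ∈ Finset.range j, (if IsFar q s i j then f i j else 0) =
      ∑ l ∈ Finset.range (n + s * q), ∑ k ∈ Finset.range l, G k l := by
    rw [sum_range_shift (s * q)]
    refine Finset.sum_congr rfl fun l _ => ?_
    split_ifs with hl
    · rw [sum_range_shift (s * q), Nat.sub_add_cancel hl]
      refine Finset.sum_congr rfl fun k _ => ?_
      simp only [hG, hl, true_and]
      by_cases hk : s * q ≤ k <;> simp [hk]
    · exact (Finset.sum_eq_zero fun k _ => if_neg fun h => hl h.2.1).symm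
  have hzero : ∀ l, 2 * q ≤ l % (3 * q) → ∑ k ∈ Finset.range l, G k l = 0 := fun l hl =>
    Finset.sum_eq_zero fun k _ => by
      by_contra h
      have := (hG0 k l h).2.1
      omega
  rw [h1, sum_range_eq_sum_residues (by omega) hd _ hzero]
  refine Finset.sum_congr rfl fun b hb => ?_
  rw [Finset.sum_comm]
  refine Finset.sum_congr rfl fun v _ => ?_
  have hb' : b < 3 * q := by have := Finset.mem_range.1 hb; omega
  have hdiv : ∀ {b v : ℕ}, b < 3 * q → (3 * q * v + b) / (3 * q) = v := fun {b v} hb => by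
    rw [Nat.mul_add_div hd, Nat.div_eq_of_lt hb, add_zero]
  rw [sum_range_eq_sum_residues (by omega : 2 * q ≤ 3 * q) hd _ (ψ := fun k => G k (3 * q * v + b))
    fun k hk => by
      by_contra h
      have := (hG0 _ _ h).1
      omega]
  refine Finset.sum_congr rfl fun a ha => ?_
  have ha' : a < 3 * q := by have := Finset.mem_range.1 ha; omega
  -- The order of the two indices allows also `u = v` when `a < b`; those terms vanish because far
  -- pairs lie in different blocks.
  have hsub : Finset.range v ⊆ Finset.range ((3 * q * v + b + (3 * q - 1) - a) / (3 * q)) := by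
    rw [Finset.range_subset_range, Nat.le_div_iff_mul_le hd, mul_comm v]
    omega
  rw [← Finset.sum_subset hsub]
  · refine Finset.sum_congr rfl fun u hu => ?_
    simp only [hG, pairCoeff]
    by_cases h2 : s * q ≤ 3 * q * u + a
    · by_cases h3 : s * q ≤ 3 * q * v + b
      · have hfar : IsFar q s (3 * q * u + a - s * q) (3 * q * v + b - s * q) ↔
            commonShift q (3 * q * u + a - s * q) (3 * q * v + b - s * q) = s := by
          unfold IsFar
          rw [Nat.sub_add_cancel h2, Nat.sub_add_cancel h3, hdiv ha', hdiv hb']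
          simp [Finset.mem_range.1 hu]
        simp [h2, h3, hfar]
      · simp [h3]
    · simp [h2]
  · intro u _ hu
    by_contra h
    have := (hG0 _ _ h).2.2
    rw [hdiv ha', hdiv hb'] at this
    exact hu (Finset.mem_range.2 this)

variable {S : Type*}

/-- The part of the `U`-statistic carried by pairs of different blocks. -/
noncomputable def blockSum (h : S → S → E) (q s n : ℕ) (w : ℕ → ℕ → S) : E :=
  ∑ b ∈ Finset.range (2 * q), ∑ a ∈ Finset.range (2 * q),
    ∑ v ∈ Finset.range (blockCount q s n b), ∑ u ∈ Finset.range v,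
      pairCoeff q s a b u v • h (w u a) (w v b)

/-- The sum of the norms over pairs of close indices. -/
noncomputable def nearSum {Ω : Type*} (h : S → S → E) (X : ℕ → Ω → S) (q N : ℕ) (ω : Ω) : ℝ :=
  ∑ j ∈ Finset.range N, ∑ i ∈ Finset.Ico (j + 1 - 2 * q) j, ‖h (X (i + 1) ω) (X (j + 1) ω)‖

lemma uStat_eq {Ω : Type*} (h : S → S → E) (X : ℕ → Ω → S) (n : ℕ) (ω : Ω) :
    uStat h X n ω =
      ∑ j ∈ Finset.range n, ∑ i ∈ Finset.range j, h (X (i + 1) ω) (X (j + 1) ω) := by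
  have e : ∀ m : ℕ, ∀ φ : ℕ → E, ∑ j ∈ Finset.Ico 1 (m + 1), φ j =
      ∑ j ∈ Finset.range m, φ (j + 1) := fun m φ => by
    rw [Finset.sum_Ico_eq_sum_range]
    simp [add_comm]
  unfold uStat
  rw [show Finset.Icc 1 n = Finset.Ico 1 (n + 1) by ext; simp, e]
  exact Finset.sum_congr rfl fun j _ => e j _

lemma norm_uStat_le {Ω : Type*} (h : S → S → E) (X : ℕ → Ω → S) {q n N : ℕ} (hq : 1 ≤ q)
    (hn : n ≤ N) (ω : Ω) :
    ‖uStat h X n ω‖ ≤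
      nearSum h X q N ω + ∑ s ∈ Finset.range 3, ‖blockSum h q s n (block X q s ω)‖ := by
  rw [uStat_eq]
  refine (norm_sum_pairs_le hq (fun i j => h (X (i + 1) ω) (X (j + 1) ω)) hn).trans ?_
  refine add_le_add le_rfl (Finset.sum_le_sum fun s _ => le_of_eq ?_)
  rw [sum_isFar_eq hq]
  congr 1
  refine Finset.sum_congr rfl fun b hb => Finset.sum_congr rfl fun a ha =>
    Finset.sum_congr rfl fun v _ => Finset.sum_congr rfl fun u _ => ?_
  have e : ∀ u a, a ∈ Finset.range (2 * q) →
      3 * q * u + a - s * q = blockIdx q s u a := fun u a ha => by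
    unfold blockIdx
    rw [min_eq_left (by have := Finset.mem_range.1 ha; omega)]
  simp only [block, ← e _ _ ha, ← e _ _ hb]

end Decomposition

/-! ### Truncation and projection of a degenerate kernel -/

section Truncation

variable {S : Type*} [MeasurableSpace S] {μ : Measure S} [IsProbabilityMeasure μ]
variable {E : Type*} [NormedAddCommGroup E] [InnerProductSpace ℝ E] [CompleteSpace E]
  [SecondCountableTopology E] [MeasurableSpace E] [BorelSpace E]

/-- The projection of the kernel `k` onto the kernels degenerate in both variables. -/
noncomputable def degenProj (μ : Measure S) (k : S → S → E) (x y : S) : E :=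
  k x y - ∫ y', k x y' ∂μ - ∫ x', k x' y ∂μ + ∫ x', ∫ y', k x' y' ∂μ ∂μ

variable {k : S → S → E}

lemma BddMeas.integral_right (hk : BddMeas (Function.uncurry k)) :
    BddMeas fun x => ∫ y, k x y ∂μ := by
  obtain ⟨hm, C, hC⟩ := hk
  refine ⟨hm.stronglyMeasurable.integral_prod_right.measurable, C, fun x => ?_⟩
  simpa using norm_integral_le_of_norm_le_const (μ := μ)
    (Filter.Eventually.of_forall fun y => hC (x, y))

lemma BddMeas.flip (hk : BddMeas (Function.uncurry k)) :
    BddMeas (Function.uncurry fun y x => k x y) :=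
  hk.comp measurable_swap

lemma BddMeas.section_left (hk : BddMeas (Function.uncurry k)) (y : S) : BddMeas fun x => k x y :=
  hk.comp measurable_prodMk_right

lemma BddMeas.section_right (hk : BddMeas (Function.uncurry k)) (x : S) : BddMeas fun y => k x y :=
  hk.comp measurable_prodMk_left

lemma BddMeas.integral_add {α F : Type*} [MeasurableSpace α] [NormedAddCommGroup F]
    [NormedSpace ℝ F] [MeasurableSpace F] [BorelSpace F] [SecondCountableTopology F]
    {ρ : Measure α} [IsFiniteMeasure ρ] {f g : α → F} (hf : BddMeas f) (hg : BddMeas g) :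
    ∫ x, f x + g x ∂ρ = ∫ x, f x ∂ρ + ∫ x, g x ∂ρ :=
  MeasureTheory.integral_add (hf.integrable ρ) (hg.integrable ρ)

lemma BddMeas.integral_sub {α F : Type*} [MeasurableSpace α] [NormedAddCommGroup F]
    [NormedSpace ℝ F] [MeasurableSpace F] [BorelSpace F] [SecondCountableTopology F]
    {ρ : Measure α} [IsFiniteMeasure ρ] {f g : α → F} (hf : BddMeas f) (hg : BddMeas g) :
    ∫ x, f x - g x ∂ρ = ∫ x, f x ∂ρ - ∫ x, g x ∂ρ :=
  MeasureTheory.integral_sub (hf.integrable ρ) (hg.integrable ρ)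

/-- Boundedness makes every section integrable, so degeneracy holds at every point rather than
almost everywhere. -/
lemma isBddDegenerate_degenProj (hk : BddMeas (Function.uncurry k)) :
    IsBddDegenerate μ (degenProj μ k) := by
  have hr : BddMeas fun x => ∫ y, k x y ∂μ := hk.integral_right
  have hl : BddMeas fun y => ∫ x, k x y ∂μ := hk.flip.integral_right
  have hswap : ∫ x, ∫ y, k x y ∂μ ∂μ = ∫ y, ∫ x, k x y ∂μ ∂μ :=
    integral_integral_swap (hk.integrable _)
  refine ⟨((hk.sub (hr.comp measurable_fst)).sub (hl.comp measurable_snd)).add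
    (BddMeas.const _), fun y => ?_, fun x => ?_⟩
  · have h1 := hk.section_left y
    simp only [degenProj]
    rw [((h1.sub hr).sub (.const _)).integral_add (.const _), (h1.sub hr).integral_sub (.const _),
      h1.integral_sub hr]
    simp
  · have h1 := hk.section_right x
    simp only [degenProj]
    rw [((h1.sub (.const _)).sub hl).integral_add (.const _), (h1.sub (.const _)).integral_sub hl,
      h1.integral_sub (.const _)]
    simp [hswap]

lemma norm_integral_rpow_le {α : Type*} [MeasurableSpace α] {ρ : Measure α} [IsProbabilityMeasure ρ]
    {f : α → E} (hf : BddMeas f) {r : ℝ} (hr : 1 ≤ r) :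
    ‖∫ x, f x ∂ρ‖ ^ r ≤ ∫ x, ‖f x‖ ^ r ∂ρ := by
  refine (Real.rpow_le_rpow (norm_nonneg _) (norm_integral_le_integral_norm f)
    (by linarith)).trans ?_
  exact (convexOn_rpow hr).map_integral_le
    (Real.continuous_rpow_const (by linarith)).continuousOn isClosed_Ici
    (Filter.Eventually.of_forall fun x => norm_nonneg (f x)) (hf.norm.integrable ρ)
    ((hf.norm_rpow (by linarith)).integrable ρ)

/-- Each of the four terms of the projection has `r`-th moment at most that of `k`, by Jensen; the
power mean inequality supplies `4 ^ (r - 1)`. -/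
lemma integral_norm_degenProj_rpow_le (hk : BddMeas (Function.uncurry k)) {r : ℝ} (hr : 1 ≤ r) :
    ∫ y, ∫ x, ‖degenProj μ k x y‖ ^ r ∂μ ∂μ ≤ 4 ^ r * ∫ x, ∫ y, ‖k x y‖ ^ r ∂μ ∂μ := by
  have hr0 : 0 ≤ r := by linarith
  have hR : BddMeas fun x => ∫ y, k x y ∂μ := hk.integral_right
  have hL : BddMeas fun y => ∫ x, k x y ∂μ := hk.flip.integral_right
  have hkr : BddMeas (Function.uncurry fun x y => ‖k x y‖ ^ r) := hk.norm_rpow hr0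
  set J := ∫ x, ∫ y, ‖k x y‖ ^ r ∂μ ∂μ
  have hJ : ∫ y, ∫ x, ‖k x y‖ ^ r ∂μ ∂μ = J := (integral_integral_swap (hkr.integrable _)).symm
  have h1 : ∫ x, ‖∫ y, k x y ∂μ‖ ^ r ∂μ ≤ J :=
    integral_mono ((hR.norm_rpow hr0).integrable _) (hkr.integral_right.integrable _)
      fun x => norm_integral_rpow_le (hk.section_right x) hr
  have h2 : ∫ y, ‖∫ x, k x y ∂μ‖ ^ r ∂μ ≤ J := by
    rw [← hJ]
    exact integral_mono ((hL.norm_rpow hr0).integrable _) (hkr.flip.integral_right.integrable _)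
      fun y => norm_integral_rpow_le (hk.section_left y) hr
  have h3 : ‖∫ x, ∫ y, k x y ∂μ ∂μ‖ ^ r ≤ J := (norm_integral_rpow_le hR hr).trans h1
  have hpt : ∀ a b c d : E, ‖a - b - c + d‖ ^ r ≤
      4 ^ (r - 1) * (‖a‖ ^ r + ‖b‖ ^ r + ‖c‖ ^ r + ‖d‖ ^ r) := fun a b c d => by
    have h := Real.rpow_sum_le_const_mul_sum_rpow (Finset.univ : Finset (Fin 4))
      ![‖a‖, ‖b‖, ‖c‖, ‖d‖] hr
    simp [Fin.sum_univ_four] at h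
    refine (Real.rpow_le_rpow (norm_nonneg _) ?_ hr0).trans h
    calc _ ≤ ‖a - b - c‖ + ‖d‖ := norm_add_le _ _
      _ ≤ _ := by gcongr; exact (norm_sub_le _ _).trans (by gcongr; exact norm_sub_le _ _)
  have hD := (isBddDegenerate_degenProj (μ := μ) hk).bddMeas.norm_rpow hr0
  have hinner : ∀ y, ∫ x, ‖degenProj μ k x y‖ ^ r ∂μ ≤
      4 ^ (r - 1) * (∫ x, ‖k x y‖ ^ r ∂μ + ‖∫ x, k x y ∂μ‖ ^ r + 2 * J) := by
    intro y
    have i1 := (hk.section_left y).norm_rpow hr0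
    have i2 := hR.norm_rpow hr0
    have i3 := (i1.add i2).add (.const (‖∫ x, k x y ∂μ‖ ^ r))
    have i4 := i3.add (.const (‖∫ x, ∫ y, k x y ∂μ ∂μ‖ ^ r))
    have hle := integral_mono ((hD.comp (measurable_prodMk_right (y := y))).integrable μ)
      (((BddMeas.const ((4 : ℝ) ^ (r - 1))).mul i4).integrable μ) fun x => hpt (k x y) _ _ _
    refine hle.trans ?_
    rw [integral_const_mul]
    gcongr
    rw [i3.integral_add (.const _), (i1.add i2).integral_add (.const _), i1.integral_add i2]
    simp only [integral_const, probReal_univ, one_smul]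
    linarith
  have i1 := hkr.flip.integral_right (μ := μ)
  have i2 := hL.norm_rpow hr0
  have hD' : BddMeas (Function.uncurry fun x y => ‖degenProj μ k x y‖ ^ r) := hD
  refine (integral_mono (hD'.flip.integral_right.integrable μ)
    (((BddMeas.const ((4 : ℝ) ^ (r - 1))).mul
      ((i1.add i2).add (.const (2 * J)))).integrable μ) hinner).trans ?_
  rw [integral_const_mul, (i1.add i2).integral_add (.const _), i1.integral_add i2]
  simp only [integral_const, probReal_univ, one_smul]
  rw [hJ]
  have h4 : (4 : ℝ) ^ r = 4 ^ (r - 1) * 4 := by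
    rw [Real.rpow_sub_one (by norm_num)]; ring
  rw [h4, mul_assoc]
  gcongr
  linarith

/-- The kernel `h`, truncated at level `R`. -/
noncomputable def truncKernel (h : S → S → E) (R : ℝ) (x y : S) : E :=
  {p : S × S | ‖h p.1 p.2‖ ≤ R}.indicator (Function.uncurry h) (x, y)

variable {h : S → S → E}

lemma bddMeas_truncKernel (hh : Measurable (Function.uncurry h)) {R : ℝ} (hR : 0 < R) :
    BddMeas (Function.uncurry (truncKernel h R)) := by
  have hm : MeasurableSet {p : S × S | ‖h p.1 p.2‖ ≤ R} := measurableSet_le hh.norm measurable_const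
  refine ⟨hh.indicator hm, R, fun p => ?_⟩
  change ‖{p : S × S | ‖h p.1 p.2‖ ≤ R}.indicator (Function.uncurry h) p‖ ≤ R
  by_cases hp : p ∈ {p : S × S | ‖h p.1 p.2‖ ≤ R}
  · rw [Set.indicator_of_mem hp]; exact hp
  · rw [Set.indicator_of_notMem hp]; simpa using hR.le

lemma ofReal_integral_truncKernel (hh : Measurable (Function.uncurry h)) {R r : ℝ} (hR : 0 < R)
    (hr : 0 < r) :
    ENNReal.ofReal (∫ x, ∫ y, ‖truncKernel h R x y‖ ^ r ∂μ ∂μ) =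
      ∫⁻ p in {p : S × S | ‖h p.1 p.2‖ ≤ R}, ‖h p.1 p.2‖ₑ ^ r ∂(μ.prod μ) := by
  have hm : MeasurableSet {p : S × S | ‖h p.1 p.2‖ ≤ R} := measurableSet_le hh.norm measurable_const
  have hb := (bddMeas_truncKernel hh hR).norm_rpow hr.le
  have e : ∫ x, ∫ y, ‖truncKernel h R x y‖ ^ r ∂μ ∂μ =
      ∫ p, ‖Function.uncurry (truncKernel h R) p‖ ^ r ∂(μ.prod μ) :=
    (integral_prod _ (hb.integrable _)).symm
  rw [e, ofReal_integral_eq_lintegral_ofReal (hb.integrable _)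
    (Filter.Eventually.of_forall fun p => by positivity), ← lintegral_indicator hm]
  refine lintegral_congr fun p => ?_
  change ENNReal.ofReal (‖{p : S × S | ‖h p.1 p.2‖ ≤ R}.indicator (Function.uncurry h) p‖ ^ r) = _
  by_cases hp : p ∈ {p : S × S | ‖h p.1 p.2‖ ≤ R}
  · rw [Set.indicator_of_mem hp, Set.indicator_of_mem hp,
      ← ENNReal.ofReal_rpow_of_nonneg (norm_nonneg _) hr.le, ofReal_norm]
    rfl
  · rw [Set.indicator_of_notMem hp, Set.indicator_of_notMem hp]
    simp [Real.zero_rpow hr.ne']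

/-- A degenerate `h` is its own projection almost everywhere, so the difference is the projection of
`d = h - k`, the part of `h` above level `R`. Each of its four terms has first moment at most that
of `d`. -/
lemma lintegral_sub_degenProj_le (hh : Measurable (Function.uncurry h))
    (hi : Integrable (Function.uncurry h) (μ.prod μ))
    (h₁ : ∀ᵐ x ∂μ, ∫ y, h x y ∂μ = 0) (h₂ : ∀ᵐ y ∂μ, ∫ x, h x y ∂μ = 0) {R : ℝ} (hR : 0 < R) :
    ∫⁻ p, ‖h p.1 p.2 - degenProj μ (truncKernel h R) p.1 p.2‖ₑ ∂(μ.prod μ) ≤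
      4 * ∫⁻ p in {p : S × S | R < ‖h p.1 p.2‖}, ‖h p.1 p.2‖ₑ ∂(μ.prod μ) := by
  have hm : MeasurableSet {p : S × S | R < ‖h p.1 p.2‖} := measurableSet_lt measurable_const hh.norm
  have hk := bddMeas_truncKernel hh hR
  set k := truncKernel h R with hkdef
  set d : S → S → E := fun x y => h x y - k x y with hd
  have hdm : Measurable (Function.uncurry d) := hh.sub hk.1
  set τ := ∫⁻ p in {p : S × S | R < ‖h p.1 p.2‖}, ‖h p.1 p.2‖ₑ ∂(μ.prod μ) with hτ
  have hdτ : ∫⁻ p, ‖d p.1 p.2‖ₑ ∂(μ.prod μ) = τ := by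
    rw [hτ, ← lintegral_indicator hm]
    refine lintegral_congr fun p => ?_
    change ‖h p.1 p.2 - {p : S × S | ‖h p.1 p.2‖ ≤ R}.indicator (Function.uncurry h) p‖ₑ = _
    by_cases hp : ‖h p.1 p.2‖ ≤ R
    · have h1 : p ∈ {p : S × S | ‖h p.1 p.2‖ ≤ R} := hp
      have h2 : p ∉ {p : S × S | R < ‖h p.1 p.2‖} := fun h' => (not_lt.2 hp) h'
      rw [Set.indicator_of_mem h1, Set.indicator_of_notMem h2]
      simp [Function.uncurry]
    · have h1 : p ∉ {p : S × S | ‖h p.1 p.2‖ ≤ R} := hp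
      have h2 : p ∈ {p : S × S | R < ‖h p.1 p.2‖} := not_le.1 hp
      rw [Set.indicator_of_notMem h1, Set.indicator_of_mem h2, sub_zero]
  have hR' : BddMeas fun x => ∫ y, k x y ∂μ := hk.integral_right
  have hL' : BddMeas fun y => ∫ x, k x y ∂μ := hk.flip.integral_right
  -- Here degeneracy enters: the partial integrals of `k` and `d` are opposite.
  have hp1 : ∀ᵐ x ∂μ, ‖∫ y, k x y ∂μ‖ₑ ≤ ∫⁻ y, ‖d x y‖ₑ ∂μ := by
    filter_upwards [h₁, hi.prod_right_ae] with x hx hxi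
    have : ∫ y, k x y ∂μ = -∫ y, d x y ∂μ := by
      have e := integral_sub hxi ((hk.section_right x).integrable μ)
      simp only [Function.uncurry_apply_pair] at e
      rw [e, hx, zero_sub, neg_neg]
    rw [this, enorm_neg]
    exact enorm_integral_le_lintegral_enorm _
  have hp2 : ∀ᵐ y ∂μ, ‖∫ x, k x y ∂μ‖ₑ ≤ ∫⁻ x, ‖d x y‖ₑ ∂μ := by
    filter_upwards [h₂, hi.prod_left_ae] with y hy hyi
    have : ∫ x, k x y ∂μ = -∫ x, d x y ∂μ := by
      have e := integral_sub hyi ((hk.section_left y).integrable μ)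
      simp only [Function.uncurry_apply_pair] at e
      rw [e, hy, zero_sub, neg_neg]
    rw [this, enorm_neg]
    exact enorm_integral_le_lintegral_enorm _
  have hI1 : ∫⁻ x, ‖∫ y, k x y ∂μ‖ₑ ∂μ ≤ τ := by
    refine (lintegral_mono_ae hp1).trans (le_of_eq ?_)
    rw [← hdτ]
    exact (lintegral_prod _ hdm.enorm.aemeasurable).symm
  have hI2 : ∫⁻ y, ‖∫ x, k x y ∂μ‖ₑ ∂μ ≤ τ := by
    refine (lintegral_mono_ae hp2).trans (le_of_eq ?_)
    rw [← hdτ]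
    exact (lintegral_prod_symm _ hdm.enorm.aemeasurable).symm
  have hI3 : ‖∫ x, ∫ y, k x y ∂μ ∂μ‖ₑ ≤ τ := (enorm_integral_le_lintegral_enorm _).trans hI1
  have hpt : ∀ p : S × S, ‖h p.1 p.2 - degenProj μ k p.1 p.2‖ₑ ≤
      ‖d p.1 p.2‖ₑ + ‖∫ y, k p.1 y ∂μ‖ₑ + ‖∫ x, k x p.2 ∂μ‖ₑ + ‖∫ x, ∫ y, k x y ∂μ ∂μ‖ₑ := by
    intro p
    have : h p.1 p.2 - degenProj μ k p.1 p.2 = d p.1 p.2 + ∫ y, k p.1 y ∂μ + ∫ x, k x p.2 ∂μ -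
        ∫ x, ∫ y, k x y ∂μ ∂μ := by
      simp only [hd, degenProj]; abel
    rw [this]
    refine enorm_sub_le.trans ?_
    gcongr
    refine (enorm_add_le _ _).trans ?_
    gcongr
    exact enorm_add_le _ _
  refine (lintegral_mono hpt).trans ?_
  have m1 : Measurable fun p : S × S => ‖d p.1 p.2‖ₑ := hdm.enorm
  have m2 : Measurable fun p : S × S => ‖∫ y, k p.1 y ∂μ‖ₑ := (hR'.1.comp measurable_fst).enorm
  have m3 : Measurable fun p : S × S => ‖∫ x, k x p.2 ∂μ‖ₑ := (hL'.1.comp measurable_snd).enorm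
  rw [lintegral_add_right _ measurable_const, lintegral_add_right _ m3, lintegral_add_right _ m2,
    hdτ, lintegral_const, measure_univ, mul_one]
  have e2 : ∫⁻ p : S × S, ‖∫ y, k p.1 y ∂μ‖ₑ ∂(μ.prod μ) = ∫⁻ x, ‖∫ y, k x y ∂μ‖ₑ ∂μ :=
    measurePreserving_fst.lintegral_comp hR'.1.enorm
  have e3 : ∫⁻ p : S × S, ‖∫ x, k x p.2 ∂μ‖ₑ ∂(μ.prod μ) = ∫⁻ y, ‖∫ x, k x y ∂μ‖ₑ ∂μ :=
    measurePreserving_snd.lintegral_comp hL'.1.enorm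
  rw [e2, e3]
  calc _ ≤ τ + τ + τ + τ := by gcongr
    _ = 4 * τ := by ring

end Truncation

/-! ### Tail bounds for the sums over pairs of independent blocks -/

section Tail

variable {S : Type*} [MeasurableSpace S] {μ : Measure S} [IsProbabilityMeasure μ]
  {ν : ℕ → Measure (ℕ → S)} [∀ i, IsProbabilityMeasure (ν i)]
variable {E : Type*} [NormedAddCommGroup E] [InnerProductSpace ℝ E] [CompleteSpace E]
  [SecondCountableTopology E] [MeasurableSpace E] [BorelSpace E]

lemma measurable_blockSum {h : S → S → E} (hh : Measurable (Function.uncurry h)) (q s n : ℕ) :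
    Measurable (blockSum h q s n) := by
  unfold blockSum
  refine Finset.measurable_sum _ fun b _ => Finset.measurable_sum _ fun a _ =>
    Finset.measurable_sum _ fun v _ => Finset.measurable_sum _ fun u _ => Measurable.const_smul ?_ _
  exact hh.comp (f := fun w : ℕ → ℕ → S => (w u a, w v b)) (by fun_prop)

lemma dependsOn_blockSum (h : S → S → E) {q s n M : ℕ} (hM : ∀ b, blockCount q s n b ≤ M) :
    DependsOn (blockSum h q s n) (Set.Iio M) := by
  intro w w' hw
  refine Finset.sum_congr rfl fun b _ => Finset.sum_congr rfl fun a _ =>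
    Finset.sum_congr rfl fun v hv => Finset.sum_congr rfl fun u hu => ?_
  have hv' := (Finset.mem_range.1 hv).trans_le (hM b)
  rw [hw u ((Finset.mem_range.1 hu).trans hv'), hw v hv']

lemma blockCount_le {q s n N : ℕ} (hq : 1 ≤ q) (hs : s ≤ 2) (hn : n ≤ N) (b : ℕ) :
    blockCount q s n b ≤ (N + 2 * q - 1) / (3 * q) + 1 := by
  unfold blockCount
  rw [← Nat.add_div_right _ (by omega : 0 < 3 * q)]
  have : s * q ≤ 2 * q := by gcongr
  exact Nat.div_le_div_right (by omega)

/-- Changing `n` only changes where each martingale, one per pair of offsets, is stopped. So all `n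
≤ N` are controlled by the `4q²` maxima up to `M`, combined by the power mean inequality and Markov.
-/
lemma measure_blockSum_le_of_isBddDegenerate {g : S → S → E} (hg : IsBddDegenerate μ g)
    (hν : ∀ u b, MeasurePreserving (fun y : ℕ → S => y b) (ν u) μ) {r : ℝ} (hr : 2 ≤ r)
    {q s N M : ℕ} (hq : 1 ≤ q) (hM0 : 0 < M) (hM : ∀ n ≤ N, ∀ b, blockCount q s n b ≤ M)
    {y : ℝ} (hy : 0 < y) :
    (Measure.infinitePi ν) {w | ∃ n ≤ N, y < ‖blockSum g q s n w‖} ≤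
      ENNReal.ofReal (y ^ (-r) * ((4 * (q : ℝ) ^ 2) ^ r *
        (2 ^ r * momentConst r ^ 2 * (M : ℝ) ^ r * ∫ z, ∫ x, ‖g x z‖ ^ r ∂μ ∂μ))) := by
  set D : ℕ × ℕ → ℕ → (ℕ → ℕ → S) → E := fun p v w =>
    ∑ u ∈ Finset.range v, pairCoeff q s p.2 p.1 u v • g (w u p.2) (w v p.1) with hD
  set Y : ℕ × ℕ → (ℕ → ℕ → S) → ℝ := fun p w =>
    partialSups (fun j => ‖∑ v ∈ Finset.range j, D p v w‖) M with hY
  set B := 2 ^ r * momentConst r ^ 2 * (M : ℝ) ^ r * ∫ z, ∫ x, ‖g x z‖ ^ r ∂μ ∂μ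
  set I := Finset.range (2 * q) ×ˢ Finset.range (2 * q)
  have hmd : ∀ p, IsMartDiff ν (D p) := fun p => hg.isMartDiff_snd hν _ _ _
  have hYb : ∀ p, BddMeas (Y p) := fun p =>
    BddMeas.partialSups (fun j => ((hmd p).bddMeas_sum j).norm) M
  have hY0 : ∀ p w, 0 ≤ Y p w := fun p w =>
    (norm_nonneg _).trans (le_partialSups (fun j => ‖∑ v ∈ Finset.range j, D p v w‖) M)
  have hYr : ∀ p, ∫ w, Y p w ^ r ∂(Measure.infinitePi ν) ≤ B := fun p =>
    hg.maximal_moment_le hν (fun u v => abs_pairCoeff_le q s p.2 p.1 u v) p.2 p.1 hr hM0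
  have hcard : ((I.card : ℕ) : ℝ) = 4 * (q : ℝ) ^ 2 := by
    simp [I]; ring
  have hsum0 : ∀ w, 0 ≤ ∑ p ∈ I, Y p w := fun w => Finset.sum_nonneg fun p _ => hY0 p w
  have hsumb : BddMeas fun w => ∑ p ∈ I, Y p w := BddMeas.sum _ fun p _ => hYb p
  have hsumr := hsumb.rpow hsum0 (p := r) (by linarith)
  have hnorm : ∀ n ≤ N, ∀ w, ‖blockSum g q s n w‖ ≤ ∑ p ∈ I, Y p w := by
    intro n hn w
    rw [Finset.sum_product]
    refine norm_sum_le_of_le _ fun b _ => norm_sum_le_of_le _ fun a _ => ?_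
    exact le_partialSups_of_le (fun j => ‖∑ v ∈ Finset.range j, D (b, a) v w‖) (hM n hn b)
  have hint : ∫ w, (∑ p ∈ I, Y p w) ^ r ∂(Measure.infinitePi ν) ≤ (4 * (q : ℝ) ^ 2) ^ r * B := by
    have hpt : ∀ w, (∑ p ∈ I, Y p w) ^ r ≤ (4 * (q : ℝ) ^ 2) ^ (r - 1) * ∑ p ∈ I, Y p w ^ r :=
      fun w => by
        rw [← hcard]
        exact Real.rpow_sum_le_const_mul_sum_rpow_of_nonneg _ (by linarith) fun p _ => hY0 p w
    have hYrb : ∀ p, BddMeas fun w => Y p w ^ r := fun p => (hYb p).rpow (hY0 p) (by linarith)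
    refine (integral_mono (hsumr.integrable _) (((BddMeas.const _).mul
      (BddMeas.sum _ fun p _ => hYrb p)).integrable _) hpt).trans ?_
    rw [integral_const_mul, integral_finsetSum _ fun p _ => (hYrb p).integrable _]
    calc _ ≤ (4 * (q : ℝ) ^ 2) ^ (r - 1) * ∑ p ∈ I, B := by gcongr with p; exact hYr p
      _ = (4 * (q : ℝ) ^ 2) ^ r * B := by
        have hc : (0 : ℝ) < 4 * (q : ℝ) ^ 2 := by positivity
        rw [Finset.sum_const, nsmul_eq_mul, hcard, Real.rpow_sub_one hc.ne']
        field_simp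
  have hmarkov := mul_meas_ge_le_integral_of_nonneg
    (Filter.Eventually.of_forall fun w => Real.rpow_nonneg (hsum0 w) r)
    (hsumr.integrable (Measure.infinitePi ν)) (y ^ r)
  have hsub : {w | ∃ n ≤ N, y < ‖blockSum g q s n w‖} ⊆ {w | y ^ r ≤ (∑ p ∈ I, Y p w) ^ r} := by
    rintro w ⟨n, hn, hw⟩
    exact Real.rpow_le_rpow hy.le (hw.le.trans (hnorm n hn w)) (by linarith)
  refine (measure_mono hsub).trans ?_
  rw [← ofReal_measureReal]
  refine ENNReal.ofReal_le_ofReal ?_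
  rw [Real.rpow_neg hy.le, le_inv_mul_iff₀ (by positivity)]
  exact hmarkov.trans hint

/-- No cancellation is used: at most `(2q)² M²` terms, each evaluated at an independent pair because
`u < v`. -/
lemma measure_blockSum_le_of_measurable {d : S → S → E} (hd : Measurable (Function.uncurry d))
    (hν : ∀ u b, MeasurePreserving (fun y : ℕ → S => y b) (ν u) μ)
    {q s N M : ℕ} (hM : ∀ n ≤ N, ∀ b, blockCount q s n b ≤ M) {y : ℝ} (hy : 0 < y) :
    (Measure.infinitePi ν) {w | ∃ n ≤ N, y < ‖blockSum d q s n w‖} ≤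
      ENNReal.ofReal y⁻¹ * ((2 * q) ^ 2 * M ^ 2 * ∫⁻ p, ‖d p.1 p.2‖ₑ ∂(μ.prod μ)) := by
  set D := ∫⁻ p, ‖d p.1 p.2‖ₑ ∂(μ.prod μ)
  set Z : (ℕ → ℕ → S) → ℝ≥0∞ := fun w => ∑ b ∈ Finset.range (2 * q), ∑ a ∈ Finset.range (2 * q),
    ∑ v ∈ Finset.range M, ∑ u ∈ Finset.range v, ‖d (w u a) (w v b)‖ₑ with hZ
  have hdm : Measurable fun p : S × S => ‖d p.1 p.2‖ₑ := hd.enorm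
  have hm : ∀ u a v b, Measurable fun w : ℕ → ℕ → S => ‖d (w u a) (w v b)‖ₑ := fun u a v b =>
    hdm.comp (f := fun w : ℕ → ℕ → S => (w u a, w v b)) (by fun_prop)
  have hnorm : ∀ n ≤ N, ∀ w, ‖blockSum d q s n w‖ₑ ≤ Z w := by
    intro n hn w
    refine (enorm_sum_le _ _).trans (Finset.sum_le_sum fun b _ => ?_)
    refine (enorm_sum_le _ _).trans (Finset.sum_le_sum fun a _ => ?_)
    refine ((enorm_sum_le _ _).trans (Finset.sum_le_sum fun v _ => ?_)).trans
      (Finset.sum_le_sum_of_subset (Finset.range_subset_range.2 (hM n hn b)))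
    refine (enorm_sum_le _ _).trans (Finset.sum_le_sum fun u _ => ?_)
    rw [enorm_smul]
    refine mul_le_of_le_one_left zero_le ?_
    rw [Real.enorm_eq_ofReal_abs]
    exact ENNReal.ofReal_le_one.2 (abs_pairCoeff_le q s a b u v)
  have hint : ∫⁻ w, Z w ∂(Measure.infinitePi ν) ≤ (2 * q) ^ 2 * M ^ 2 * D := by
    have e : ∫⁻ w, Z w ∂(Measure.infinitePi ν) = ∑ b ∈ Finset.range (2 * q),
        ∑ a ∈ Finset.range (2 * q), ∑ v ∈ Finset.range M, ∑ u ∈ Finset.range v, D := by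
      rw [hZ, lintegral_finsetSum _ fun b _ => by fun_prop]
      refine Finset.sum_congr rfl fun b _ => ?_
      rw [lintegral_finsetSum _ fun a _ => by fun_prop]
      refine Finset.sum_congr rfl fun a _ => ?_
      rw [lintegral_finsetSum _ fun v _ => by fun_prop]
      refine Finset.sum_congr rfl fun v _ => ?_
      rw [lintegral_finsetSum _ fun u _ => by fun_prop]
      refine Finset.sum_congr rfl fun u hu => ?_
      exact lintegral_pair hν (Finset.mem_range.1 hu).ne a b hdm
    rw [e]
    calc _ ≤ ∑ b ∈ Finset.range (2 * q), ∑ a ∈ Finset.range (2 * q), ∑ v ∈ Finset.range M,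
          ∑ u ∈ Finset.range M, D := by
          gcongr with b _ a _ v hv
          exact (Finset.mem_range.1 hv).le
      _ = _ := by simp only [Finset.sum_const, Finset.card_range, nsmul_eq_mul]; push_cast; ring
  have hZm : Measurable Z := by
    simp only [hZ]
    fun_prop
  have hsub : {w | ∃ n ≤ N, y < ‖blockSum d q s n w‖} ⊆ {w | ENNReal.ofReal y ≤ Z w} := by
    rintro w ⟨n, hn, hw⟩
    refine le_trans ?_ (hnorm n hn w)
    rw [← ofReal_norm]
    exact ENNReal.ofReal_le_ofReal hw.le
  refine (measure_mono hsub).trans ((meas_ge_le_lintegral_div hZm.aemeasurable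
    (by simpa using hy) (by simp)).trans ?_)
  rw [ENNReal.div_eq_inv_mul, ENNReal.ofReal_inv_of_pos hy]
  gcongr

lemma measure_nearSum_le {Ω : Type*} [MeasurableSpace Ω] {P : Measure Ω}
    [IsProbabilityMeasure P] {X : ℕ → Ω → S} (hX : StrictlyStationary P X) {h : S → S → E}
    (hh : Measurable (Function.uncurry h)) (q N : ℕ) {y : ℝ} (hy : 0 < y) :
    P {ω | y < nearSum h X q N ω} ≤ ENNReal.ofReal y⁻¹ * (N * (2 * q) *
      ⨆ (j : ℕ) (_ : 2 ≤ j), ∫⁻ ω, ‖h (X 1 ω) (X j ω)‖ₑ ∂P) := by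
  set I := ⨆ (j : ℕ) (_ : 2 ≤ j), ∫⁻ ω, ‖h (X 1 ω) (X j ω)‖ₑ ∂P with hI
  have hhm : Measurable fun p : S × S => ‖h p.1 p.2‖ₑ := hh.enorm
  have hXm : ∀ i, Measurable (X (i + 1)) := fun i => hX.1 _ (by omega)
  have hm : ∀ i j, Measurable fun ω => ‖h (X (i + 1) ω) (X (j + 1) ω)‖ₑ := fun i j =>
    hhm.comp ((hXm i).prodMk (hXm j))
  have hpair : ∀ i j, i < j → ∫⁻ ω, ‖h (X (i + 1) ω) (X (j + 1) ω)‖ₑ ∂P ≤ I := by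
    intro i j hij
    obtain ⟨k, rfl⟩ := Nat.exists_eq_add_of_lt hij
    have e := congrArg (fun ρ => ∫⁻ p, ‖h p.1 p.2‖ₑ ∂ρ) (hX.map_pair i (k + 1))
    simp only [lintegral_map hhm ((hXm i).prodMk (hXm (i + (k + 1)))),
      lintegral_map hhm ((hXm 0).prodMk (hXm (k + 1)))] at e
    rw [add_assoc i k 1, e]
    exact le_iSup₂ (f := fun (j : ℕ) (_ : 2 ≤ j) => ∫⁻ ω, ‖h (X 1 ω) (X j ω)‖ₑ ∂P)
      (k + 1 + 1) (by omega)
  set Z : Ω → ℝ≥0∞ := fun ω => ∑ j ∈ Finset.range N, ∑ i ∈ Finset.Ico (j + 1 - 2 * q) j,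
    ‖h (X (i + 1) ω) (X (j + 1) ω)‖ₑ with hZ
  have hZm : Measurable Z := by
    simp only [hZ]
    fun_prop
  have hint : ∫⁻ ω, Z ω ∂P ≤ N * (2 * q) * I := by
    rw [hZ, lintegral_finsetSum _ fun b _ => by fun_prop]
    calc _ ≤ ∑ j ∈ Finset.range N, ((2 * q : ℕ) : ℝ≥0∞) * I := by
          refine Finset.sum_le_sum fun j _ => ?_
          rw [lintegral_finsetSum _ fun b _ => by fun_prop]
          refine (Finset.sum_le_card_nsmul _ _ I fun i hi =>
            hpair i j (Finset.mem_Ico.1 hi).2).trans ?_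
          rw [nsmul_eq_mul]
          gcongr
          rw [Nat.card_Ico]
          omega
      _ = _ := by rw [Finset.sum_const, Finset.card_range, nsmul_eq_mul]; push_cast; ring
  have hsub : {ω | y < nearSum h X q N ω} ⊆ {ω | ENNReal.ofReal y ≤ Z ω} := by
    intro ω hω
    refine (ENNReal.ofReal_le_ofReal (le_of_lt hω)).trans (le_of_eq ?_)
    unfold nearSum
    rw [ENNReal.ofReal_sum_of_nonneg fun j _ => Finset.sum_nonneg fun i _ => norm_nonneg _]
    refine Finset.sum_congr rfl fun j _ => ?_
    rw [ENNReal.ofReal_sum_of_nonneg fun i _ => norm_nonneg _]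
    exact Finset.sum_congr rfl fun i _ => ofReal_norm _
  refine (measure_mono hsub).trans ((meas_ge_le_lintegral_div hZm.aemeasurable
    (by simpa using hy) (by simp)).trans ?_)
  rw [ENNReal.div_eq_inv_mul, ENNReal.ofReal_inv_of_pos hy]
  gcongr

/-- The tail bound for the maximum of the sums over pairs of independent blocks. -/
lemma measure_blockSum_le {h : S → S → E} (hh : Measurable (Function.uncurry h))
    (hi : Integrable (Function.uncurry h) (μ.prod μ))
    (h₁ : ∀ᵐ x ∂μ, ∫ y, h x y ∂μ = 0) (h₂ : ∀ᵐ y ∂μ, ∫ x, h x y ∂μ = 0)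
    (hν : ∀ u b, MeasurePreserving (fun y : ℕ → S => y b) (ν u) μ) {r R : ℝ} (hr : 2 ≤ r)
    (hR : 0 < R) {q s N M : ℕ} (hq : 1 ≤ q) (hM0 : 0 < M)
    (hM : ∀ n ≤ N, ∀ b, blockCount q s n b ≤ M) (hMN : M * q ≤ 2 * N) {x : ℝ} (hx : 0 < x) :
    (Measure.infinitePi ν) {w | ∃ n ≤ N, x / 4 < ‖blockSum h q s n w‖} ≤
      ENNReal.ofReal (256 ^ r * (2 ^ r * momentConst r ^ 2)) * ENNReal.ofReal (x ^ (-r)) *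
        (q : ℝ≥0∞) ^ r * (N : ℝ≥0∞) ^ r *
        (∫⁻ p in {p : S × S | ‖h p.1 p.2‖ ≤ R}, ‖h p.1 p.2‖ₑ ^ r ∂(μ.prod μ)) +
      512 * ENNReal.ofReal x⁻¹ * (N : ℝ≥0∞) ^ 2 *
        (∫⁻ p in {p : S × S | R < ‖h p.1 p.2‖}, ‖h p.1 p.2‖ₑ ∂(μ.prod μ)) := by
  have hk := bddMeas_truncKernel hh hR
  have hg := isBddDegenerate_degenProj (μ := μ) hk
  set g := degenProj μ (truncKernel h R)
  set d : S → S → E := fun x y => h x y - g x y with hd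
  have hdm : Measurable (Function.uncurry d) := hh.sub hg.bddMeas.1
  have hsplit : ∀ n w, blockSum h q s n w = blockSum g q s n w + blockSum d q s n w := by
    intro n w
    unfold blockSum
    simp only [← Finset.sum_add_distrib, ← smul_add, hd, add_sub_cancel]
  have hsub : {w | ∃ n ≤ N, x / 4 < ‖blockSum h q s n w‖} ⊆
      {w | ∃ n ≤ N, x / 8 < ‖blockSum g q s n w‖} ∪
        {w | ∃ n ≤ N, x / 8 < ‖blockSum d q s n w‖} := by
    rintro w ⟨n, hn, hw⟩
    by_contra hcon
    have hc1 : ‖blockSum g q s n w‖ ≤ x / 8 := by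
      by_contra! hlt
      exact hcon (Or.inl ⟨n, hn, hlt⟩)
    have hc2 : ‖blockSum d q s n w‖ ≤ x / 8 := by
      by_contra! hlt
      exact hcon (Or.inr ⟨n, hn, hlt⟩)
    rw [hsplit] at hw
    linarith [norm_add_le (blockSum g q s n w) (blockSum d q s n w)]
  refine (measure_mono hsub).trans ((measure_union_le _ _).trans (add_le_add ?_ ?_))
  · refine (measure_blockSum_le_of_isBddDegenerate hg hν hr hq hM0 hM (by positivity)).trans ?_
    rw [← ofReal_integral_truncKernel hh hR (by linarith : 0 < r)]
    set J := ∫ x, ∫ y, ‖truncKernel h R x y‖ ^ r ∂μ ∂μ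
    have hJ0 : 0 ≤ J := integral_nonneg fun x => integral_nonneg fun y => by positivity
    have hJ := integral_norm_degenProj_rpow_le (μ := μ) hk (by linarith : 1 ≤ r)
    rw [← ENNReal.ofReal_natCast q, ← ENNReal.ofReal_natCast N,
      ENNReal.ofReal_rpow_of_nonneg (by positivity) (by linarith),
      ENNReal.ofReal_rpow_of_nonneg (by positivity) (by linarith),
      ← ENNReal.ofReal_mul (by positivity), ← ENNReal.ofReal_mul (by positivity),
      ← ENNReal.ofReal_mul (by positivity), ← ENNReal.ofReal_mul (by positivity)]
    refine ENNReal.ofReal_le_ofReal ?_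
    have e1 : (x / 8) ^ (-r) = 8 ^ r * x ^ (-r) := by
      rw [Real.div_rpow hx.le (by norm_num), Real.rpow_neg (by norm_num : (0 : ℝ) ≤ 8)]
      field_simp
    have hMN' : (M : ℝ) * q ≤ 2 * N := by exact_mod_cast hMN
    have e2 : (4 * (q : ℝ) ^ 2) ^ r * (M : ℝ) ^ r ≤ 8 ^ r * (q : ℝ) ^ r * (N : ℝ) ^ r := by
      rw [← Real.mul_rpow (by positivity) (by positivity),
        ← Real.mul_rpow (by positivity) (by positivity),
        ← Real.mul_rpow (by positivity) (by positivity)]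
      refine Real.rpow_le_rpow (by positivity) ?_ (by linarith)
      have := mul_le_mul_of_nonneg_left hMN' (by positivity : (0 : ℝ) ≤ 4 * q)
      linarith
    -- The factors come from the level `x / 8`, from `4q²M ≤ 8qN`, and from the projection.
    have e3 : (256 : ℝ) ^ r = 8 ^ r * 8 ^ r * 4 ^ r := by
      rw [← Real.mul_rpow (by norm_num) (by norm_num), ← Real.mul_rpow (by norm_num) (by norm_num)]
      norm_num
    rw [e1, e3]
    calc _ = 8 ^ r * x ^ (-r) * (2 ^ r * momentConst r ^ 2) *
          ((4 * (q : ℝ) ^ 2) ^ r * (M : ℝ) ^ r) * ∫ y, ∫ x, ‖g x y‖ ^ r ∂μ ∂μ := by ring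
      _ ≤ 8 ^ r * x ^ (-r) * (2 ^ r * momentConst r ^ 2) *
          (8 ^ r * (q : ℝ) ^ r * (N : ℝ) ^ r) * (4 ^ r * J) := by
          gcongr
      _ = _ := by ring
  · refine (measure_blockSum_le_of_measurable hdm hν hM (by positivity)).trans ?_
    have hτ := lintegral_sub_degenProj_le hh hi h₁ h₂ hR
    set τ := ∫⁻ p in {p : S × S | R < ‖h p.1 p.2‖}, ‖h p.1 p.2‖ₑ ∂(μ.prod μ)
    have e1 : ENNReal.ofReal (x / 8)⁻¹ = 8 * ENNReal.ofReal x⁻¹ := by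
      rw [inv_div, div_eq_mul_inv, ENNReal.ofReal_mul (by norm_num)]; simp
    have hMN' : (M : ℝ≥0∞) * q ≤ 2 * N := by exact_mod_cast hMN
    rw [e1]
    -- The constant 512 is 8 (level `x / 8`) times 16 (from `4(Mq)² ≤ 16N²`) times 4 (projection).
    calc _ = 8 * ENNReal.ofReal x⁻¹ * (4 * ((M : ℝ≥0∞) * q) ^ 2 *
          ∫⁻ p, ‖d p.1 p.2‖ₑ ∂(μ.prod μ)) := by ring
      _ ≤ 8 * ENNReal.ofReal x⁻¹ * (4 * (2 * (N : ℝ≥0∞)) ^ 2 * (4 * τ)) := by gcongr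
      _ = _ := by ring

end Tail

/-! ### Degeneracy with respect to an independent copy -/

section Copy

lemma setIntegral_eq_zero_of_condExp {Ω E : Type*} [NormedAddCommGroup E] [NormedSpace ℝ E]
    [CompleteSpace E] {m m₀ : MeasurableSpace Ω} {P : Measure Ω} [IsFiniteMeasure P] {f : Ω → E}
    (hf : Integrable f P) (hm : m ≤ m₀) (h0 : P[f | m] =ᵐ[P] 0) {A : Set Ω}
    (hA : MeasurableSet[m] A) : ∫ ω in A, f ω ∂P = 0 := by
  rw [← setIntegral_condExp hm hf hA, setIntegral_congr_ae (hm A hA) (h0.mono fun ω hω _ => hω)]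
  simp

variable {Ω Ω' S E : Type*} [MeasurableSpace Ω] [MeasurableSpace Ω'] [MeasurableSpace S]
  [NormedAddCommGroup E] [InnerProductSpace ℝ E] [CompleteSpace E]
  [SecondCountableTopology E] [MeasurableSpace E] [BorelSpace E]
  {P : Measure Ω} [IsProbabilityMeasure P] {P' : Measure Ω'} [IsProbabilityMeasure P']
  {Y : Ω → S} {ξ ξ' : Ω' → S} {h : S → S → E}

lemma IsIndepCopyPair.measurePreserving (hc : IsIndepCopyPair P Y P' ξ ξ') :
    MeasurePreserving (fun ω => (ξ ω, ξ' ω)) P' ((P.map Y).prod (P.map Y)) := by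
  refine ⟨hc.measurable_fst.prodMk hc.measurable_snd, ?_⟩
  rw [(indepFun_iff_map_prod_eq_prod_map_map hc.measurable_fst.aemeasurable
    hc.measurable_snd.aemeasurable).1 hc.indep, hc.law_fst, hc.law_snd]

lemma IsIndepCopyPair.isProbabilityMeasure (hc : IsIndepCopyPair P Y P' ξ ξ') :
    IsProbabilityMeasure (P.map Y) :=
  hc.law_fst ▸ Measure.isProbabilityMeasure_map hc.measurable_fst.aemeasurable

lemma IsDegenerate.integrable_prod (hd : IsDegenerate h P' ξ ξ')
    (hc : IsIndepCopyPair P Y P' ξ ξ') (hh : Measurable (Function.uncurry h)) :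
    Integrable (Function.uncurry h) ((P.map Y).prod (P.map Y)) :=
  (hc.measurePreserving.integrable_comp hh.aestronglyMeasurable).1 hd.integrable

/-- Integrating over `ξ ∈ B` turns the conditional statement into vanishing integrals of the partial
integral over every measurable `B`. -/
lemma IsDegenerate.ae_integral_right (hd : IsDegenerate h P' ξ ξ')
    (hc : IsIndepCopyPair P Y P' ξ ξ') (hh : Measurable (Function.uncurry h)) :
    ∀ᵐ x ∂(P.map Y), ∫ y, h x y ∂(P.map Y) = 0 := by
  have := hc.isProbabilityMeasure
  have hi := hd.integrable_prod hc hh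
  refine hi.integral_prod_left.ae_eq_zero_of_forall_setIntegral_eq_zero
    fun B hB _ => ?_
  have h1 := setIntegral_eq_zero_of_condExp hd.integrable hc.measurable_fst.comap_le
    hd.condExp_fst ⟨B, hB, rfl⟩
  have h2 := setIntegral_map (μ := P') (hB.prod MeasurableSet.univ)
    (f := Function.uncurry h) hh.aestronglyMeasurable hc.measurePreserving.measurable.aemeasurable
  rw [hc.measurePreserving.map_eq, setIntegral_prod _ hi.integrableOn] at h2
  simp only [Measure.restrict_univ] at h2
  refine h2.trans (Eq.trans ?_ h1)
  congr 2
  ext ω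
  simp

lemma IsDegenerate.ae_integral_left (hd : IsDegenerate h P' ξ ξ')
    (hc : IsIndepCopyPair P Y P' ξ ξ') (hh : Measurable (Function.uncurry h)) :
    ∀ᵐ y ∂(P.map Y), ∫ x, h x y ∂(P.map Y) = 0 := by
  have hc' : IsIndepCopyPair P Y P' ξ' ξ :=
    ⟨hc.measurable_snd, hc.measurable_fst, hc.law_snd, hc.law_fst, hc.indep.symm⟩
  have hd' : IsDegenerate (fun x y => h y x) P' ξ' ξ :=
    ⟨hd.integrable, hd.condExp_snd, hd.condExp_fst⟩
  exact hd'.ae_integral_right hc' (hh.comp measurable_swap)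

end Copy

/-! ### Assembly of the tail bound. -/

lemma exists_lt_norm_uStat {Ω S E : Type*} [NormedAddCommGroup E] {h : S → S → E} {X : ℕ → Ω → S}
    {N : ℕ} {x : ℝ} (hx : 0 < x) {ω : Ω} (hω : x < (maxUStat h X N ω : ℝ)) :
    ∃ n ≤ N, x < ‖uStat h X n ω‖ := by
  by_contra! hcon
  have : maxUStat h X N ω ≤ ⟨x, hx.le⟩ :=
    Finset.sup_le fun n hn => hcon n (Finset.mem_Icc.1 hn).2
  exact absurd hω (not_lt.2 this)

/-- The constant in the tail bound for the maximum of degenerate `U`-statistics. -/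
noncomputable def tailConst (r : ℝ) : ℝ≥0 :=
  3 * (256 ^ r * (2 ^ r * momentConst r ^ 2)).toNNReal + 1536

lemma measure_maxUStat_le {Ω Ω' S E : Type*} [MeasurableSpace Ω] [MeasurableSpace Ω']
    [MeasurableSpace S] [NormedAddCommGroup E] [InnerProductSpace ℝ E] [CompleteSpace E]
    [SecondCountableTopology E] [MeasurableSpace E] [BorelSpace E]
    {P : Measure Ω} [IsProbabilityMeasure P] {P' : Measure Ω'} [IsProbabilityMeasure P']
    {X : ℕ → Ω → S} {ξ ξ' : Ω' → S} {h : S → S → E} {N q : ℕ} {r R x : ℝ} (hr : 2 ≤ r)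
    (hqN : 2 * q < N) (hq : 1 ≤ q) (hR : 0 < R) (hx : 0 < x) (hX : StrictlyStationary P X)
    (hh : Measurable (Function.uncurry h)) (hc : IsIndepCopyPair P (X 1) P' ξ ξ')
    (hd : IsDegenerate h P' ξ ξ') :
    P {ω | x < (maxUStat h X N ω : ℝ)} ≤
      tailConst r * ENNReal.ofReal (x ^ (-r)) * (q : ℝ≥0∞) ^ r * (N : ℝ≥0∞) ^ r *
          (∫⁻ ω in {ω | ‖h (ξ ω) (ξ' ω)‖ ≤ R}, ‖h (ξ ω) (ξ' ω)‖ₑ ^ r ∂P')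
        + tailConst r * ENNReal.ofReal x⁻¹ * (N : ℝ≥0∞) ^ 2 *
          (∫⁻ ω in {ω | R < ‖h (ξ ω) (ξ' ω)‖}, ‖h (ξ ω) (ξ' ω)‖ₑ ∂P')
        + tailConst r * ENNReal.ofReal x⁻¹ * (q : ℝ≥0∞) * (N : ℝ≥0∞) *
          (⨆ (j : ℕ) (_ : 2 ≤ j), ∫⁻ ω, ‖h (X 1 ω) (X j ω)‖ₑ ∂P)
        + 4 * (N : ℝ≥0∞) * betaMixing P X q := by
  have := hc.isProbabilityMeasure
  set μ := P.map (X 1)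
  have hmp := hc.measurePreserving
  have hhm : Measurable fun p : S × S => ‖h p.1 p.2‖ₑ := hh.enorm
  have e1 : ∫⁻ ω in {ω | ‖h (ξ ω) (ξ' ω)‖ ≤ R}, ‖h (ξ ω) (ξ' ω)‖ₑ ^ r ∂P' =
      ∫⁻ p in {p : S × S | ‖h p.1 p.2‖ ≤ R}, ‖h p.1 p.2‖ₑ ^ r ∂(μ.prod μ) :=
    hmp.setLIntegral_comp_preimage (measurableSet_le hh.norm measurable_const) (hhm.pow_const r)
  have e2 : ∫⁻ ω in {ω | R < ‖h (ξ ω) (ξ' ω)‖}, ‖h (ξ ω) (ξ' ω)‖ₑ ∂P' =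
      ∫⁻ p in {p : S × S | R < ‖h p.1 p.2‖}, ‖h p.1 p.2‖ₑ ∂(μ.prod μ) :=
    hmp.setLIntegral_comp_preimage (measurableSet_lt measurable_const hh.norm) hhm
  rw [e1, e2]
  set m := (N + 2 * q - 1) / (3 * q) with hm
  have hm1 : 3 * (m * q) + 1 ≤ N + 2 * q := by
    have := Nat.div_mul_le_self (N + 2 * q - 1) (3 * q)
    rw [← hm] at this
    have e : m * (3 * q) = 3 * (m * q) := by ring
    omega
  have hMN : (m + 1) * q ≤ 2 * N := by rw [add_mul]; omega
  -- Three shifts, `m` paid replacements each, `2β` per replacement; `2q < N` gives `3m ≤ 2N`, hence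
  -- the coefficient `4N`.
  have h6m : 6 * m ≤ 4 * N := by nlinarith [Nat.le_mul_of_pos_right m hq]
  set β := betaMixing P X q
  set I₁ := ∫⁻ p in {p : S × S | ‖h p.1 p.2‖ ≤ R}, ‖h p.1 p.2‖ₑ ^ r ∂(μ.prod μ)
  set I₂ := ∫⁻ p in {p : S × S | R < ‖h p.1 p.2‖}, ‖h p.1 p.2‖ₑ ∂(μ.prod μ)
  set I₃ := ⨆ (j : ℕ) (_ : 2 ≤ j), ∫⁻ ω, ‖h (X 1 ω) (X j ω)‖ₑ ∂P
  set A : ℕ → Set (ℕ → ℕ → S) := fun s => {w | ∃ n ≤ N, x / 4 < ‖blockSum h q s n w‖} with hA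
  set K := 256 ^ r * (2 ^ r * momentConst r ^ 2)
  set T := ENNReal.ofReal K * ENNReal.ofReal (x ^ (-r)) * (q : ℝ≥0∞) ^ r * (N : ℝ≥0∞) ^ r * I₁ +
    512 * ENNReal.ofReal x⁻¹ * (N : ℝ≥0∞) ^ 2 * I₂ with hT
  have hAs : ∀ s ∈ Finset.range 3, P {ω | block X q s ω ∈ A s} ≤ T + m * (2 * β) := by
    intro s hs
    have hs2 : s ≤ 2 := by have := Finset.mem_range.1 hs; omega
    have hM : ∀ n ≤ N, ∀ b, blockCount q s n b ≤ m + 1 := fun n hn b => blockCount_le hq hs2 hn b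
    have hAm : MeasurableSet (A s) := by
      have : A s = ⋃ n ∈ Set.Iic N, {w | x / 4 < ‖blockSum h q s n w‖} := by
        ext w; simp [hA]
      rw [this]
      exact MeasurableSet.biUnion (Set.to_countable _) fun n _ =>
        measurableSet_lt measurable_const (measurable_blockSum hh q s n).norm
    have hAd : DependsOn (· ∈ A s) (Set.Iio (m + 1)) := by
      intro w w' hw
      have : ∀ n ≤ N, blockSum h q s n w = blockSum h q s n w' := fun n hn =>
        dependsOn_blockSum h (hM n hn) hw
      simp only [hA, Set.mem_ofPred_eq, eq_iff_iff]
      exact exists_congr fun n => and_congr_right fun hn => by rw [this n hn]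
    refine (hX.measure_block_le hq hs2 hAm m hAd).trans ?_
    gcongr
    have : ∀ u, IsProbabilityMeasure (P.map fun ω => block X q s ω u) := fun u =>
      Measure.isProbabilityMeasure_map
        ((measurable_pi_apply u).comp (hX.measurable_block q s)).aemeasurable
    exact measure_blockSum_le hh (hd.integrable_prod hc hh) (hd.ae_integral_right hc hh)
      (hd.ae_integral_left hc hh) (hX.measurePreserving_block q s) hr hR hq (Nat.succ_pos m) hM
      hMN hx
  -- The level is split into four quarters: the near pairs and the three shifts.
  have hsub : {ω | x < (maxUStat h X N ω : ℝ)} ⊆ {ω | x / 4 < nearSum h X q N ω} ∪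
      ⋃ s ∈ Finset.range 3, {ω | block X q s ω ∈ A s} := by
    intro ω hω
    obtain ⟨n, hn, hlt⟩ := exists_lt_norm_uStat hx hω
    by_contra hcon
    simp only [Set.mem_union, Set.mem_iUnion, not_or, not_exists] at hcon
    have h1 : nearSum h X q N ω ≤ x / 4 := not_lt.1 hcon.1
    have h2 : ∀ s ∈ Finset.range 3, ‖blockSum h q s n (block X q s ω)‖ ≤ x / 4 := fun s hs => by
      by_contra! h'
      exact hcon.2 s hs ⟨n, hn, h'⟩
    have h3 := norm_uStat_le h X hq hn ω
    have h4 := Finset.sum_le_card_nsmul _ _ _ h2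
    rw [Finset.card_range, nsmul_eq_mul] at h4
    push_cast at h4
    linarith
  have hnear := measure_nearSum_le hX hh q N (y := x / 4) (by positivity)
  have e4 : ENNReal.ofReal (x / 4)⁻¹ = 4 * ENNReal.ofReal x⁻¹ := by
    rw [inv_div, div_eq_mul_inv, ENNReal.ofReal_mul (by norm_num)]; simp
  rw [e4] at hnear
  have hC1 : 3 * ENNReal.ofReal K ≤ tailConst r := by
    unfold tailConst
    push_cast
    exact le_self_add
  have hC2 : (1536 : ℝ≥0∞) ≤ tailConst r := by
    unfold tailConst
    push_cast
    exact le_add_self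
  have h6m' : (6 : ℝ≥0∞) * m ≤ 4 * N := by exact_mod_cast h6m
  calc P {ω | x < (maxUStat h X N ω : ℝ)} ≤ P {ω | x / 4 < nearSum h X q N ω} +
        ∑ s ∈ Finset.range 3, P {ω | block X q s ω ∈ A s} :=
        (measure_mono hsub).trans ((measure_union_le _ _).trans
          (add_le_add le_rfl (measure_biUnion_finset_le _ _)))
    _ ≤ 4 * ENNReal.ofReal x⁻¹ * (N * (2 * q) * I₃) +
        ∑ s ∈ Finset.range 3, (T + m * (2 * β)) := add_le_add hnear (Finset.sum_le_sum hAs)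
    _ = 3 * ENNReal.ofReal K * ENNReal.ofReal (x ^ (-r)) * (q : ℝ≥0∞) ^ r * (N : ℝ≥0∞) ^ r * I₁ +
        1536 * ENNReal.ofReal x⁻¹ * (N : ℝ≥0∞) ^ 2 * I₂ +
        8 * ENNReal.ofReal x⁻¹ * (q : ℝ≥0∞) * (N : ℝ≥0∞) * I₃ + 6 * m * β := by
        rw [Finset.sum_const, Finset.card_range, nsmul_eq_mul, hT]
        push_cast
        ring
    _ ≤ _ := by
        have h8 : (8 : ℝ≥0∞) ≤ tailConst r := le_trans (by norm_num) hC2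
        gcongr

end UStatMixing

theorem mainTheorem6 (r : ℝ) (hr : 2 ≤ r) :
    ∃ C : ℝ≥0,
      ∀ (Ω Ω' S E : Type*) [MeasurableSpace Ω] [MeasurableSpace Ω']
        [MetricSpace S] [TopologicalSpace.SeparableSpace S] [MeasurableSpace S] [BorelSpace S]
        [NormedAddCommGroup E] [InnerProductSpace ℝ E] [CompleteSpace E]
        [TopologicalSpace.SeparableSpace E] [MeasurableSpace E] [BorelSpace E]
        (P : Measure Ω) [IsProbabilityMeasure P] (P' : Measure Ω') [IsProbabilityMeasure P']
        (X : ℕ → Ω → S) (ξ ξ' : Ω' → S) (h : S → S → E) (N q : ℕ) (R x : ℝ),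
        2 * q < N → 1 ≤ 2 * q → 0 < R → 0 < x →
        UStatMixing.StrictlyStationary P X →
        Measurable (Function.uncurry h) →
        UStatMixing.IsIndepCopyPair P (X 1) P' ξ ξ' →
        UStatMixing.IsDegenerate h P' ξ ξ' →
        P {ω | x < (UStatMixing.maxUStat h X N ω : ℝ)} ≤
          C * ENNReal.ofReal (x ^ (-r)) * (q : ℝ≥0∞) ^ r * (N : ℝ≥0∞) ^ r *
              (∫⁻ ω in {ω | ‖h (ξ ω) (ξ' ω)‖ ≤ R}, ‖h (ξ ω) (ξ' ω)‖ₑ ^ r ∂P')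
            + C * ENNReal.ofReal x⁻¹ * (N : ℝ≥0∞) ^ 2 *
              (∫⁻ ω in {ω | R < ‖h (ξ ω) (ξ' ω)‖}, ‖h (ξ ω) (ξ' ω)‖ₑ ∂P')
            + C * ENNReal.ofReal x⁻¹ * (q : ℝ≥0∞) * (N : ℝ≥0∞) *
              (⨆ (j : ℕ) (_ : 2 ≤ j), ∫⁻ ω, ‖h (X 1 ω) (X j ω)‖ₑ ∂P)
            + 4 * (N : ℝ≥0∞) * UStatMixing.betaMixing P X q := by

  refine ⟨UStatMixing.tailConst r, ?_⟩
  intro Ω Ω' S E _ _ _ _ _ _ _ _ _ _ _ _ P _ P' _ X ξ ξ' h N q R x hqN hq hR hx hX hh hc hd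
  have := UniformSpace.secondCountable_of_separable E
  exact UStatMixing.measure_maxUStat_le hr hqN (by omega) hR hx hX hh hc hd
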